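/- Let $V:\{1,2,3,\dots\}\to\mathbb{R}$ be bounded and let $H$ be the half-line discrete Schrödinger operator on $\ell^2(\mathbb{N})$, $\mathbb{N}=\{1,2,\dots\}$, $$(H\psi)_n=\psi_{n+1}+\psi_{n-1}+V_n\psi_n,\qquad \psi_0:=0 .$$ For $q\in\mathbb{N}$ and $T>0$ let $$P(q,T)=\sum_{n>q}\frac{2}{T}\int_0^\infty\left|\langle\delta_n,e^{-itH}\delta_1\rangle\right|^2e^{-2t/T}\,dt .$$ For $q>1$ and $k\in[0,\pi]$ let $H^q(k)$ be the Hermitian $q\times q$ matrix obtained by restricting $H$ to $\{1,\dots,q\}$ with the boundary conditions $\psi(q+1)=e^{ik}\psi(1)$, $\psi(0)=e^{-ik}\psi(q)$, i.e. $V_1,\dots,V_q$ on the diagonal, $1$ next to the diagonal, and additional contributions $e^{-ik}$ at the entry $(1,q)$ and $e^{ik}$ at the entry $(q,1)$ (added to the entry $1$ if $q=2$). Let $E_{q,1}(k)\le E_{q,2}(k)\le\dots\le E_{q,q}(k)$ be its eigenvalues, counted with multiplicity, and let $b_{q,j}=|E_{q,j}(\pi)-E_{q,j}(0)|$ for $1\le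 j\le q$. Then, for every integer $q>1$ and every real $T\ge 1$, $$P(q,T)\le\frac{4e^2}{(\sqrt5+1)^2}\,(1+2\|V\|_\infty)^2\,T^6\,\Bigl(\sup_{1\le j\le q}b_{q,j}\Bigr)^2 .$$ -/

import Mathlib

open scoped ENNReal

namespace HalfLine

noncomputable section

/-- The Hilbert space `ℓ²(ℕ)` over the sites `ℕ = {1, 2, 3, …}`. -/
abbrev Ell2 : Type := lp (fun _ : ℕ+ => ℂ) 2

/-- Bounded real potentials `V` on `{1, 2, 3, …}`; the norm is the supremum norm `‖V‖_∞`. -/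
abbrev Potential : Type := lp (fun _ : ℕ+ => ℝ) ∞

/-- The canonical unit vector at the site `n`. -/
def delta (n : ℕ+) : Ell2 := lp.single 2 n (1 : ℂ)

theorem toReal_two_pos : 0 < (2 : ℝ≥0∞).toReal := by norm_num

theorem sum_shift_left_le (ψ : Ell2) (s : Finset ℕ+) :
    ∑ n ∈ s, ‖ψ (n + 1)‖ ^ (2 : ℝ≥0∞).toReal ≤ ‖ψ‖ ^ (2 : ℝ≥0∞).toReal := by
  have h := lp.sum_rpow_le_norm_rpow toReal_two_pos ψ (s.map (addRightEmbedding (1 : ℕ+)))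
  simpa [Finset.sum_map] using h

theorem sum_shift_right_le (ψ : Ell2) (s : Finset ℕ+) :
    ∑ n ∈ s, ‖(if n = 1 then 0 else ψ (n - 1) : ℂ)‖ ^ (2 : ℝ≥0∞).toReal
      ≤ ‖ψ‖ ^ (2 : ℝ≥0∞).toReal := by
  classical
  have hinj : Set.InjOn (fun n : ℕ+ => n - 1) (s.filter (fun n => n ≠ 1)) := by
    intro a ha b hb hab
    have ha' : (1 : ℕ+) < a :=
      lt_of_le_of_ne one_le (Ne.symm (Finset.mem_filter.1 ha).2)
    have hb' : (1 : ℕ+) < b :=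
      lt_of_le_of_ne one_le (Ne.symm (Finset.mem_filter.1 hb).2)
    have hab' : a - 1 = b - 1 := hab
    rw [← PNat.add_sub_of_lt ha', ← PNat.add_sub_of_lt hb', hab']
  have h := lp.sum_rpow_le_norm_rpow toReal_two_pos ψ
    ((s.filter (fun n => n ≠ 1)).image (fun n : ℕ+ => n - 1))
  rw [Finset.sum_image hinj, Finset.sum_filter] at h
  refine le_trans (le_of_eq (Finset.sum_congr rfl fun n _ => ?_)) h
  by_cases hn : n = 1 <;> simp [hn]

theorem sum_mul_le (V : Potential) (ψ : Ell2) (s : Finset ℕ+) :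
    ∑ n ∈ s, ‖(V n : ℂ) * ψ n‖ ^ (2 : ℝ≥0∞).toReal
      ≤ (‖V‖ * ‖ψ‖) ^ (2 : ℝ≥0∞).toReal := by
  rw [Real.mul_rpow (norm_nonneg _) (norm_nonneg _)]
  refine le_trans (Finset.sum_le_sum (fun n _ => ?_)) (le_trans (le_of_eq (Finset.mul_sum s
    (fun n => ‖ψ n‖ ^ (2 : ℝ≥0∞).toReal) (‖V‖ ^ (2 : ℝ≥0∞).toReal)).symm) ?_)
  · rw [norm_mul, Real.mul_rpow (norm_nonneg _) (norm_nonneg _)]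
    have hV : ‖(V n : ℂ)‖ ≤ ‖V‖ := by
      rw [Complex.norm_real]
      exact lp.norm_apply_le_norm ENNReal.top_ne_zero V n
    gcongr
  · gcongr
    exact lp.sum_rpow_le_norm_rpow toReal_two_pos ψ s

/-- The bounded operator `(Lψ)ₙ = ψₙ₊₁`. -/
def shiftLeft : Ell2 →L[ℂ] Ell2 :=
  LinearMap.mkContinuous
    { toFun := fun ψ => ⟨fun n => ψ (n + 1), memℓp_gen' (sum_shift_left_le ψ)⟩
      map_add' := fun _ _ => rfl
      map_smul' := fun _ _ => rfl }
    1
    (fun ψ => by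
      rw [one_mul]
      exact lp.norm_le_of_forall_sum_le toReal_two_pos (norm_nonneg ψ) (sum_shift_left_le ψ))

/-- The bounded operator `(Rψ)ₙ = ψₙ₋₁`, with the convention `ψ₀ = 0`. -/
def shiftRight : Ell2 →L[ℂ] Ell2 :=
  LinearMap.mkContinuous
    { toFun := fun ψ =>
        ⟨fun n => if n = 1 then 0 else ψ (n - 1), memℓp_gen' (sum_shift_right_le ψ)⟩
      map_add' := fun φ ψ => by
        ext n
        change (if n = 1 then (0 : ℂ) else φ (n - 1) + ψ (n - 1)) =
          (if n = 1 then 0 else φ (n - 1)) + (if n = 1 then 0 else ψ (n - 1))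
        by_cases hn : n = 1 <;> simp [hn]
      map_smul' := fun c ψ => by
        ext n
        by_cases hn : n = 1 <;> simp [hn] }
    1
    (fun ψ => by
      rw [one_mul]
      exact lp.norm_le_of_forall_sum_le toReal_two_pos (norm_nonneg ψ) (sum_shift_right_le ψ))

/-- The bounded operator of multiplication by `V`: `ψₙ ↦ Vₙ ψₙ`. -/
def mulPotential (V : Potential) : Ell2 →L[ℂ] Ell2 :=
  LinearMap.mkContinuous
    { toFun := fun ψ => ⟨fun n => (V n : ℂ) * ψ n, memℓp_gen' (sum_mul_le V ψ)⟩
      map_add' := fun φ ψ => by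
        ext n
        exact mul_add (V n : ℂ) (φ n) (ψ n)
      map_smul' := fun c ψ => by
        ext n
        simp [mul_left_comm] }
    ‖V‖
    (fun ψ => lp.norm_le_of_forall_sum_le toReal_two_pos
      (mul_nonneg (norm_nonneg V) (norm_nonneg ψ)) (sum_mul_le V ψ))

/-- The half-line discrete Schrödinger operator `H = Δ + V` on `ℓ²(ℕ)`. -/
def schrodinger (V : Potential) : Ell2 →L[ℂ] Ell2 :=
  shiftLeft + shiftRight + mulPotential V

/-- `(Hψ)ₙ = ψₙ₊₁ + ψₙ₋₁ + Vₙ ψₙ`, where `ψ₀ = 0`. -/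
theorem schrodinger_apply (V : Potential) (ψ : Ell2) (n : ℕ+) :
    schrodinger V ψ n = ψ (n + 1) + (if n = 1 then 0 else ψ (n - 1)) + (V n : ℂ) * ψ n :=
  rfl

/-- The unitary time evolution `e^{-itH}`. -/
def evolution (V : Potential) (t : ℝ) : Ell2 →L[ℂ] Ell2 :=
  NormedSpace.exp ((-(Complex.I * (t : ℂ))) • schrodinger V)

/-- The time-averaged outside probability
`P(q, T) = ∑_{n > q} (2/T) ∫₀^∞ |⟨δₙ, e^{-itH} δ₁⟩|² e^{-2t/T} dt`,
as a sum of integrals of nonnegative functions, with values in `[0, ∞]`. -/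
def outsideProbability (V : Potential) (q : ℕ) (T : ℝ) : ℝ≥0∞ :=
  ∑' n : {n : ℕ+ // q < (n : ℕ)},
    ENNReal.ofReal (2 / T) *
      ∫⁻ t in Set.Ioi (0 : ℝ),
        ENNReal.ofReal
          (‖inner ℂ (delta n.1) (evolution V t (delta 1))‖ ^ 2 * Real.exp (-2 * t / T))

/-- The restriction `H^q(k)` of `H` to `{1, …, q}` with the boundary conditions
`ψ(q+1) = e^{ik} ψ(1)`, `ψ(0) = e^{-ik} ψ(q)`. The index `j : Fin q` stands for the site `j + 1`.
The contributions are added, so for `q = 2` the entry `(1, 2)` is `1 + e^{-ik}`. -/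
def truncation (V : Potential) (q : ℕ) (k : ℝ) : Matrix (Fin q) (Fin q) ℂ :=
  Matrix.of fun i j =>
    (if i = j then (V (Nat.succPNat (i : ℕ)) : ℂ) else 0)
      + (if (i : ℕ) + 1 = (j : ℕ) then 1 else 0)
      + (if (j : ℕ) + 1 = (i : ℕ) then 1 else 0)
      + (if (i : ℕ) = 0 ∧ (j : ℕ) + 1 = q then Complex.exp (-(Complex.I * (k : ℂ))) else 0)
      + (if (j : ℕ) = 0 ∧ (i : ℕ) + 1 = q then Complex.exp (Complex.I * (k : ℂ)) else 0)

theorem truncation_isHermitian (V : Potential) (q : ℕ) (k : ℝ) :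
    (truncation V q k).IsHermitian := by
  have h1 : (starRingEnd ℂ) (Complex.exp (Complex.I * (k : ℂ)))
      = Complex.exp (-(Complex.I * (k : ℂ))) := by
    rw [← Complex.exp_conj]; simp
  have h2 : (starRingEnd ℂ) (Complex.exp (-(Complex.I * (k : ℂ))))
      = Complex.exp (Complex.I * (k : ℂ)) := by
    rw [← Complex.exp_conj]; simp
  ext i j
  simp only [truncation, Matrix.conjTranspose_apply, Matrix.of_apply, star_add, apply_ite star,
    star_zero, star_one, RCLike.star_def, Complex.conj_ofReal, h1, h2]
  by_cases hij : i = j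
  · subst hij; simp only [if_true]; ring
  · rw [if_neg hij, if_neg (Ne.symm hij)]; ring

/-- `E_{q,j}(k)`, `j = 1, …, q`: the eigenvalues of `H^q(k)` in nondecreasing order, repeated
according to multiplicity. (Mathlib's `eigenvalues₀` lists them in nonincreasing order.) -/
def eigenvalue (V : Potential) (q : ℕ) (k : ℝ) (j : Fin q) : ℝ :=
  (truncation_isHermitian V q k).eigenvalues₀ ((finCongr (Fintype.card_fin q).symm) j.rev)

theorem eigenvalue_monotone (V : Potential) (q : ℕ) (k : ℝ) : Monotone (eigenvalue V q k) := by
  intro i j hij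
  refine (truncation_isHermitian V q k).eigenvalues₀_antitone ?_
  simpa [Fin.le_def] using Fin.rev_le_rev.2 hij

theorem roots_charpoly_truncation (V : Potential) (q : ℕ) (k : ℝ) :
    (truncation V q k).charpoly.roots
      = Multiset.map (fun j => (eigenvalue V q k j : ℂ)) Finset.univ.val := by
  rw [(truncation_isHermitian V q k).roots_charpoly_eq_eigenvalues₀]
  have h := Multiset.map_univ_val_equiv
    (Fin.revPerm.trans (finCongr (Fintype.card_fin q).symm))
  rw [← h, Multiset.map_map]
  rfl

/-- The band width `b_{q,j} = |E_{q,j}(π) - E_{q,j}(0)|`. -/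
def bandWidth (V : Potential) (q : ℕ) (j : Fin q) : ℝ :=
  |eigenvalue V q Real.pi j - eigenvalue V q 0 j|

end

end HalfLine

/-! By Plancherel in time, `P(q,T)` is `2/T` times the integral over `ξ` of `‖S^q G_V(z)‖²`. Here `z
= -2πξ + i/T`, `G_V(z) = (H - z)⁻¹ δ₁`, and `S` is the left shift, so `S^q` keeps exactly the sites
beyond `q`. It suffices to bound `‖S^q G_V(z)‖` pointwise by a constant times the norm of some
Green's function, because the same integral of `‖G(z)‖²` equals 1 for every potential, by unitarity
(`lintegral_norm_green`).

The comparison potential `W` repeats `V₁, …, V_q` periodically. The resolvent identity costs a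
factor `1 + 2‖V‖T` (`norm_shiftLeft_pow_green_le`), since `W - V` lives beyond `q`. Periodicity
makes `G_W` a Floquet solution, `S^q G_W = μ G_W` with `μ = -G_W(q)` (`shiftLeft_pow_green`), so
only `|μ|` must be controlled.

If `μ ≠ 0`, it satisfies `μ + μ⁻¹ = D(z)` for the discriminant `D`, and `|μ| ≤ 1`; hence `|μ| ≤
2/|D(z)|`. The polynomial `D` has the real zeros `x_j = E_j(π/2)`, while `D - 2` and `D + 2` have
the zeros `E_j(0)` and `E_j(π)`. Two facts bound `|D(z)|` from below: `|D'(x_j)| ≥ 4/b_j`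
(`four_div_le_prod_abs_sub`), and for each real `E` some `j` satisfies `|D'(x_j)| ≤ e ∏_{i≠j} |E -
x_i|` (`exists_prod_abs_sub_le`). With `b = sup b_j` they give `|D(z)| ≥ 4 Im z/(e b)`, hence `|μ| ≤
(e/2) b T`. This is sharper than needed; the stated constant and power of `T` follow from `√5 ≤ 3`
and `T ≥ 1`. -/

namespace HalfLine

noncomputable section

/-! ### Plancherel's theorem on the line. -/

open MeasureTheory FourierTransform SchwartzMap in
/-- The `L²` Fourier transform of an integrable function is the Fourier integral. -/
theorem fourier_toLp_ae_eq {f : ℝ → ℂ} (h1 : Integrable f) (h2 : MemLp f 2) :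
    (𝓕 (h2.toLp f) : Lp ℂ 2 (volume : Measure ℝ)) =ᵐ[volume] 𝓕 f := by
  have hcont : Continuous (𝓕 f) :=
    VectorFourier.fourierIntegral_continuous Real.continuous_fourierChar
      (by exact continuous_inner) h1
  refine ae_eq_of_integral_contDiff_smul_eq
    ((Lp.memLp (𝓕 (h2.toLp f))).locallyIntegrable (by norm_num)) hcont.locallyIntegrable ?_
  intro g g_diff g_supp
  have hg₁ : HasCompactSupport (Complex.ofRealCLM ∘ g) := g_supp.comp_left rfl
  have hg₂ : ContDiff ℝ ((⊤ : ℕ∞) : WithTop ℕ∞) (Complex.ofRealCLM ∘ g) := by fun_prop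
  set φ : 𝓢(ℝ, ℂ) := hg₁.toSchwartzMap hg₂ with hφ
  -- Both transforms are compared as tempered distributions: the Fourier transform is moved onto the
  -- test function `φ`, where the `L¹` and `L²` definitions agree.
  have e1 := congrArg (fun F : TemperedDistribution ℝ ℂ => F φ)
    (Lp.fourier_toTemperedDistribution_eq (h2.toLp f))
  simp only [TemperedDistribution.fourier_apply, Lp.toTemperedDistribution_apply] at e1
  have e2 : ∫ x, (𝓕 φ) x • (h2.toLp f) x = ∫ x, φ x • (𝓕 f) x := by
    have e3 : ∫ x, (𝓕 φ) x • (h2.toLp f) x = ∫ x, (𝓕 φ) x • f x := by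
      refine integral_congr_ae ?_
      filter_upwards [h2.coeFn_toLp] with x hx
      rw [hx]
    rw [e3]
    simpa [SchwartzMap.fourier_coe] using!
      VectorFourier.integral_fourierIntegral_smul_eq_flip (L := innerₗ ℝ)
        (f := φ) (g := f) Real.continuous_fourierChar continuous_inner φ.integrable h1
  exact e1.symm.trans e2

open MeasureTheory FourierTransform in
/-- Plancherel's theorem on `L¹ ∩ L²`. -/
theorem lintegral_enorm_fourier_sq {f : ℝ → ℂ} (h1 : Integrable f) (h2 : MemLp f 2) :
    ∫⁻ ξ, ‖𝓕 f ξ‖ₑ ^ 2 = ∫⁻ t, ‖f t‖ₑ ^ 2 := by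
  have key : eLpNorm (𝓕 f) 2 volume = eLpNorm f 2 volume := by
    rw [← eLpNorm_congr_ae (fourier_toLp_ae_eq h1 h2), ← eLpNorm_congr_ae h2.coeFn_toLp]
    have h := Lp.norm_fourier_eq (h2.toLp f)
    rw [Lp.norm_def, Lp.norm_def] at h
    exact (ENNReal.toReal_eq_toReal_iff' (Lp.eLpNorm_ne_top _) (Lp.eLpNorm_ne_top _)).1 h
  rw [eLpNorm_eq_lintegral_rpow_enorm_toReal (by norm_num) (by norm_num),
    eLpNorm_eq_lintegral_rpow_enorm_toReal (by norm_num) (by norm_num)] at key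
  have := ENNReal.rpow_left_injective (x := 1 / (2 : ℝ≥0∞).toReal) (by norm_num) key
  simpa using this

/-! ### Self-adjointness of `H` and unitarity of its evolution. -/

theorem shiftLeft_apply (ψ : Ell2) (n : ℕ+) : shiftLeft ψ n = ψ (n + 1) := rfl

theorem shiftRight_apply (ψ : Ell2) (n : ℕ+) :
    shiftRight ψ n = if n = 1 then 0 else ψ (n - 1) := rfl

theorem mulPotential_apply (V : Potential) (ψ : Ell2) (n : ℕ+) :
    mulPotential V ψ n = (V n : ℂ) * ψ n := rfl

theorem delta_apply (m n : ℕ+) : delta m n = if n = m then 1 else 0 := by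
  simp [delta, Pi.single_apply]

theorem inner_delta_left (n : ℕ+) (ψ : Ell2) : inner ℂ (delta n) ψ = ψ n := by
  simp [delta, lp.inner_single_left]

theorem norm_delta (n : ℕ+) : ‖delta n‖ = 1 := by
  simp [delta, lp.norm_single]

theorem inner_shiftLeft (φ ψ : Ell2) : inner ℂ (shiftLeft φ) ψ = inner ℂ φ (shiftRight ψ) := by
  rw [lp.inner_eq_tsum, lp.inner_eq_tsum]
  have hinj : Function.Injective (fun n : ℕ+ => n + 1) := add_left_injective 1
  -- Reindexing by `n ↦ n + 1` misses only the site 1, where `shiftRight ψ` vanishes.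
  rw [← hinj.tsum_eq (f := fun n => inner ℂ (φ n) (shiftRight ψ n))]
  · refine tsum_congr fun n => ?_
    have h1 : n + 1 ≠ 1 := fun h => absurd (congrArg PNat.val h) (by simp)
    simp only [shiftLeft_apply, shiftRight_apply, if_neg h1]
    have h2 : n + 1 - 1 = n :=
      PNat.eq (by rw [PNat.sub_coe, if_pos (one_lt_of_gt (PNat.lt_add_right n 1))]; simp)
    rw [h2]
  · intro n hn
    rcases eq_or_ne n 1 with rfl | h
    · simp [shiftRight_apply] at hn
    · have : 1 < n := lt_of_le_of_ne one_le h.symm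
      exact ⟨n - 1, by
        change n - 1 + 1 = n
        rw [add_comm]
        exact PNat.add_sub_of_lt this⟩

theorem inner_mulPotential (V : Potential) (φ ψ : Ell2) :
    inner ℂ (mulPotential V φ) ψ = inner ℂ φ (mulPotential V ψ) := by
  rw [lp.inner_eq_tsum, lp.inner_eq_tsum]
  refine tsum_congr fun n => ?_
  simp only [mulPotential_apply, RCLike.inner_apply, map_mul, Complex.conj_ofReal]
  ring

theorem schrodinger_isSelfAdjoint (V : Potential) : IsSelfAdjoint (schrodinger V) := by
  rw [ContinuousLinearMap.isSelfAdjoint_iff_isSymmetric]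
  intro φ ψ
  have h : inner ℂ (shiftRight φ) ψ = inner ℂ φ (shiftLeft ψ) := by
    rw [← inner_conj_symm, ← inner_shiftLeft, inner_conj_symm]
  simp only [schrodinger, ContinuousLinearMap.coe_coe, add_apply,
    inner_add_left, inner_add_right, inner_shiftLeft, h, inner_mulPotential]
  ring

theorem norm_evolution (V : Potential) (t : ℝ) (ψ : Ell2) : ‖evolution V t ψ‖ = ‖ψ‖ := by
  have hu : evolution V t ∈ unitary (Ell2 →L[ℂ] Ell2) := by
    let +nondep : NormedAlgebra ℚ (Ell2 →L[ℂ] Ell2) := .restrictScalars ℚ ℂ _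
    refine NormedSpace.exp_mem_unitary_of_mem_skewAdjoint ?_
    rw [skewAdjoint.mem_iff, star_smul, (schrodinger_isSelfAdjoint V).star_eq]
    simp
  have h1 := (Unitary.mem_iff.1 hu).1
  rw [ContinuousLinearMap.star_eq_adjoint] at h1
  have h2 : inner ℂ (evolution V t ψ) (evolution V t ψ) = inner ℂ ψ ψ := by
    rw [← ContinuousLinearMap.adjoint_inner_right, ← mul_apply_eq_comp, h1]
    rfl
  rw [inner_self_eq_norm_sq_to_K, inner_self_eq_norm_sq_to_K] at h2
  have h3 : ‖evolution V t ψ‖ ^ 2 = ‖ψ‖ ^ 2 := by exact_mod_cast h2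
  exact (pow_left_inj₀ (norm_nonneg _) (norm_nonneg _) two_ne_zero).1 h3

/-- `H` is placed inside the evolution so that the resolvent equation can be substituted when `ψ` is
a Green's function. -/
theorem hasDerivAt_evolution_apply (V : Potential) (t : ℝ) (ψ : Ell2) (n : ℕ+) :
    HasDerivAt (fun s : ℝ => evolution V s ψ n)
      (evolution V t ((-Complex.I) • schrodinger V ψ) n) t := by
  have h := hasDerivAt_exp_smul_const (𝕂 := ℂ) ((-Complex.I) • schrodinger V) (t : ℂ)
  have e : ∀ s : ℝ, evolution V s = NormedSpace.exp ((s : ℂ) • ((-Complex.I) • schrodinger V)) := by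
    intro s
    rw [evolution, smul_smul]
    congr 2
    ring
  have h2 := (((innerSL ℂ (delta n)).comp
    (ContinuousLinearMap.apply ℂ Ell2 ψ)).hasFDerivAt.comp_hasDerivAt (t : ℂ) h).comp_ofReal
  simp only [e]
  convert! h2 using 1
  · ext s
    exact (inner_delta_left _ _).symm
  · exact (inner_delta_left _ _).symm

theorem evolution_zero (V : Potential) : evolution V 0 = 1 := by
  simp [evolution]

/-! ### The resolvent equation in the upper half-plane. -/

/-- `(H - z) ψ` is bounded below by `Im z`. -/
theorem im_mul_norm_le (V : Potential) (z : ℂ) (ψ : Ell2) :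
    z.im * ‖ψ‖ ≤ ‖schrodinger V ψ - z • ψ‖ := by
  rcases eq_or_ne ψ 0 with rfl | hψ
  · simp
  have hpos : 0 < ‖ψ‖ := norm_pos_iff.2 hψ
  have hre : (inner ℂ ψ (schrodinger V ψ)).im = 0 := by
    have h := (ContinuousLinearMap.isSelfAdjoint_iff_isSymmetric.1 (schrodinger_isSelfAdjoint V)) ψ ψ
    have h' : (starRingEnd ℂ) (inner ℂ ψ (schrodinger V ψ)) = inner ℂ ψ (schrodinger V ψ) := by
      rw [inner_conj_symm]
      exact h
    exact Complex.conj_eq_iff_im.1 h'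
  have h1 : (inner ℂ ψ (schrodinger V ψ - z • ψ)).im = -(z.im * ‖ψ‖ ^ 2) := by
    rw [inner_sub_right, inner_smul_right, inner_self_eq_norm_sq_to_K, Complex.sub_im, hre]
    norm_cast
    simp [Complex.mul_im, -Complex.ofReal_pow]
  have h2 : z.im * ‖ψ‖ ^ 2 ≤ ‖ψ‖ * ‖schrodinger V ψ - z • ψ‖ := by
    have := (Complex.abs_im_le_norm (inner ℂ ψ (schrodinger V ψ - z • ψ))).trans
      (norm_inner_le_norm _ _)
    rw [h1, abs_neg] at this
    exact (le_abs_self _).trans this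
  refine le_of_mul_le_mul_left ?_ hpos
  linarith [h2, (by ring : ‖ψ‖ * (z.im * ‖ψ‖) = z.im * ‖ψ‖ ^ 2)]

/-- The Green's function `(H - z)⁻¹ δ₁`. -/
def green (V : Potential) (z : ℂ) : Ell2 := -(resolvent (schrodinger V) z (delta 1))

theorem schrodinger_green (V : Potential) {z : ℂ} (hz : 0 < z.im) :
    schrodinger V (green V z) = z • green V z + delta 1 := by
  have hres : z ∈ resolventSet ℂ (schrodinger V) := by
    by_contra h
    have := (schrodinger_isSelfAdjoint V).im_eq_zero_of_mem_spectrum (z := z) h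
    exact hz.ne' this
  have h1 : (algebraMap ℂ (Ell2 →L[ℂ] Ell2) z - schrodinger V) *
      resolvent (schrodinger V) z = 1 :=
    Ring.mul_inverse_cancel _ (spectrum.mem_resolventSet_iff.1 hres)
  have h2 := congrArg (fun A : Ell2 →L[ℂ] Ell2 => A (delta 1)) h1
  simp only [mul_apply_eq_comp, sub_apply,
    Algebra.algebraMap_eq_smul_one, smul_apply,
    one_apply_eq_self] at h2
  rw [green, map_neg]
  set r := resolvent (schrodinger V) z (delta 1)
  calc -schrodinger V r = -(z • r) + (z • r - schrodinger V r) := by abel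
    _ = z • -r + delta 1 := by rw [h2, smul_neg]

/-- Injectivity of `H - z`, from `im_mul_norm_le`. It is what identifies the shifted periodic
Green's function. -/
theorem eq_green_of_schrodinger (V : Potential) {z : ℂ} (hz : 0 < z.im) {ψ : Ell2} {c : ℂ}
    (h : schrodinger V ψ = z • ψ + c • delta 1) : ψ = c • green V z := by
  have h1 := im_mul_norm_le V z (ψ - c • green V z)
  have h2 : schrodinger V (ψ - c • green V z) - z • (ψ - c • green V z) = 0 := by
    rw [map_sub, map_smul, schrodinger_green V hz, h]
    module
  rw [h2, norm_zero] at h1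
  have h3 : ‖ψ - c • green V z‖ ≤ 0 := by
    by_contra hc
    push Not at hc
    nlinarith [mul_pos hz hc]
  exact sub_eq_zero.1 (norm_le_zero_iff.1 h3)

/-! ### From time averages to Green's functions. -/

section Dynamics

open MeasureTheory FourierTransform Filter Topology

/-- The damped amplitude `e^{-εt} ⟨δₙ, e^{-itH} δ₁⟩` for `t > 0`, extended by zero. -/
def dampedAmplitude (V : Potential) (ε : ℝ) (n : ℕ+) : ℝ → ℂ :=
  (Set.Ioi (0 : ℝ)).indicator
    (fun t => ((Real.exp (-ε * t) : ℝ) : ℂ) * evolution V t (delta 1) n)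

theorem continuous_evolution_apply (V : Potential) (ψ : Ell2) (n : ℕ+) :
    Continuous (fun t : ℝ => evolution V t ψ n) :=
  continuous_iff_continuousAt.2 fun t => (hasDerivAt_evolution_apply V t ψ n).continuousAt

theorem norm_evolution_apply_le (V : Potential) (t : ℝ) (ψ : Ell2) (n : ℕ+) :
    ‖evolution V t ψ n‖ ≤ ‖ψ‖ :=
  (lp.norm_apply_le_norm two_ne_zero _ n).trans_eq (norm_evolution V t ψ)

theorem integrableOn_exp_mul_evolution (V : Potential) {c : ℂ} (hc : c.re < 0) (ψ : Ell2)
    (n : ℕ+) :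
    IntegrableOn (fun t : ℝ => Complex.exp (c * t) * evolution V t ψ n) (Set.Ioi 0) := by
  refine Integrable.mono' ((integrableOn_exp_mul_Ioi hc 0).mul_const ‖ψ‖) ?_ ?_
  · refine Continuous.aestronglyMeasurable ?_
    have := continuous_evolution_apply V ψ n
    fun_prop
  · refine Eventually.of_forall fun t => ?_
    rw [norm_mul, Complex.norm_exp]
    have : (c * t).re = c.re * t := by simp
    rw [this]
    exact mul_le_mul_of_nonneg_left (norm_evolution_apply_le V t ψ n) (Real.exp_pos _).le

theorem integrable_dampedAmplitude (V : Potential) {ε : ℝ} (hε : 0 < ε) (n : ℕ+) :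
    Integrable (dampedAmplitude V ε n) := by
  rw [dampedAmplitude, integrable_indicator_iff measurableSet_Ioi]
  have := integrableOn_exp_mul_evolution V (c := ((-ε : ℝ) : ℂ)) (by simpa using hε) (delta 1) n
  simpa using this

theorem norm_dampedAmplitude_le (V : Potential) {ε : ℝ} (hε : 0 < ε) (n : ℕ+) (t : ℝ) :
    ‖dampedAmplitude V ε n t‖ ≤ 1 := by
  rw [dampedAmplitude, norm_indicator_eq_indicator_norm]
  refine Set.indicator_le' (fun t ht => ?_) (fun t _ => zero_le_one) t
  rw [norm_mul, Complex.norm_real, Real.norm_of_nonneg (Real.exp_pos _).le]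
  refine mul_le_one₀ (Real.exp_le_one_iff.2 ?_) (norm_nonneg _) ?_
  · have : 0 < ε * t := mul_pos hε ht
    linarith
  · exact (norm_evolution_apply_le V t _ n).trans_eq (norm_delta 1)

theorem memLp_dampedAmplitude (V : Potential) {ε : ℝ} (hε : 0 < ε) (n : ℕ+) :
    MemLp (dampedAmplitude V ε n) 2 := by
  have hi := integrable_dampedAmplitude V hε n
  rw [memLp_two_iff_integrable_sq_norm hi.1]
  refine Integrable.mono' hi.norm (hi.1.norm.pow 2) (Eventually.of_forall fun t => ?_)
  have := norm_dampedAmplitude_le V hε n t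
  rw [Real.norm_of_nonneg (by positivity)]
  nlinarith [norm_nonneg (dampedAmplitude V ε n t)]

/-- The spectral parameter `-2πξ + iε`. -/
def spectralParam (ε ξ : ℝ) : ℂ := -(2 * Real.pi * ξ) + Complex.I * ε

theorem spectralParam_im (ε ξ : ℝ) : (spectralParam ε ξ).im = ε := by
  simp [spectralParam]

/-- The half-line Fourier transform of the evolution is the Green's function. -/
theorem fourier_dampedAmplitude (V : Potential) {ε : ℝ} (hε : 0 < ε) (n : ℕ+) (ξ : ℝ) :
    𝓕 (dampedAmplitude V ε n) ξ = -Complex.I * green V (spectralParam ε ξ) n := by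
  set z := spectralParam ε ξ with hz
  set c : ℂ := Complex.I * z with hc
  have hcre : c.re = -ε := by simp [hc, Complex.mul_re, spectralParam_im, hz]
  have hcneg : c.re < 0 := by linarith
  have hgreen := schrodinger_green V (z := z) (by rw [spectralParam_im]; exact hε)
  have h1 : 𝓕 (dampedAmplitude V ε n) ξ
      = ∫ t in Set.Ioi (0 : ℝ), Complex.exp (c * t) * evolution V t (delta 1) n := by
    rw [Real.fourier_real_eq_integral_exp_smul, ← integral_indicator measurableSet_Ioi]
    refine integral_congr_ae (Eventually.of_forall fun t => ?_)
    by_cases ht : t ∈ Set.Ioi (0 : ℝ)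
    · simp only [dampedAmplitude, Set.indicator_of_mem ht, smul_eq_mul]
      rw [← mul_assoc, Complex.ofReal_exp, ← Complex.exp_add]
      congr 2
      rw [hc, hz, spectralParam]
      push_cast
      linear_combination (-(ε : ℂ) * t) * Complex.I_sq
    · simp [dampedAmplitude, Set.indicator_of_notMem ht]
  -- An explicit antiderivative: since `H G = z G + δ₁`, differentiating `e^{izt} e^{-itH} G`
  -- cancels the `z` terms and leaves only the evolution of `δ₁`.
  have hder : ∀ t ∈ Set.Ici (0 : ℝ), HasDerivAt
      (fun t : ℝ => Complex.exp (c * t) * evolution V t (green V z) n)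
      (-Complex.I * (Complex.exp (c * t) * evolution V t (delta 1) n)) t := by
    intro t _
    have e1 : HasDerivAt (fun t : ℝ => Complex.exp (c * t)) (Complex.exp (c * t) * c) t := by
      have : HasDerivAt (fun s : ℂ => Complex.exp (c * s)) (Complex.exp (c * t) * c) (t : ℂ) := by
        simpa using ((hasDerivAt_id (t : ℂ)).const_mul c).cexp
      exact this.comp_ofReal
    refine (e1.mul (hasDerivAt_evolution_apply V t (green V z) n)).congr_deriv ?_
    rw [hgreen, smul_add, map_add, map_smul, map_smul, map_smul]
    simp only [lp.coeFn_add, lp.coeFn_smul, Pi.add_apply, Pi.smul_apply, smul_eq_mul]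
    rw [hc]
    ring
  have hlim : Tendsto (fun t : ℝ => Complex.exp (c * t) * evolution V t (green V z) n)
      atTop (𝓝 0) := by
    have h2 : Tendsto (fun t : ℝ => Real.exp (-ε * t) * ‖green V z‖) atTop (𝓝 (0 * ‖green V z‖)) := by
      refine Tendsto.mul_const _ (Real.tendsto_exp_atBot.comp ?_)
      exact tendsto_id.const_mul_atTop_of_neg (by linarith)
    rw [zero_mul] at h2
    refine squeeze_zero_norm (fun t => ?_) h2
    rw [norm_mul, Complex.norm_exp]
    have : (c * t).re = -ε * t := by simp [hcre]
    rw [this]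
    exact mul_le_mul_of_nonneg_left (norm_evolution_apply_le V t _ n) (Real.exp_pos _).le
  have h3 := integral_Ioi_of_hasDerivAt_of_tendsto' hder
    ((integrableOn_exp_mul_evolution V hcneg (delta 1) n).const_mul (-Complex.I)) hlim
  rw [integral_const_mul, ← h1] at h3
  simp only [Complex.ofReal_zero, mul_zero, Complex.exp_zero, one_mul, evolution_zero,
    one_apply_eq_self, zero_sub] at h3
  linear_combination Complex.I * h3 + 𝓕 (dampedAmplitude V ε n) ξ * Complex.I_sq

/-- Plancherel's identity relating the evolution and the Green's function. -/
theorem lintegral_evolution_eq (V : Potential) {T : ℝ} (hT : 0 < T) (n : ℕ+) :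
    ∫⁻ t in Set.Ioi (0 : ℝ), ENNReal.ofReal
        (‖inner ℂ (delta n) (evolution V t (delta 1))‖ ^ 2 * Real.exp (-2 * t / T))
      = ∫⁻ ξ : ℝ, ‖green V (spectralParam T⁻¹ ξ) n‖ₑ ^ 2 := by
  have hε : 0 < T⁻¹ := inv_pos.2 hT
  have h := lintegral_enorm_fourier_sq (integrable_dampedAmplitude V hε n)
    (memLp_dampedAmplitude V hε n)
  simp only [fourier_dampedAmplitude V hε, enorm_mul, enorm_neg] at h
  have hI : ‖Complex.I‖ₑ = 1 := by simp [← ofReal_norm]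
  simp only [hI, one_mul] at h
  rw [h, ← lintegral_indicator measurableSet_Ioi]
  refine lintegral_congr fun t => ?_
  by_cases ht : t ∈ Set.Ioi (0 : ℝ)
  · simp only [dampedAmplitude, Set.indicator_of_mem ht, inner_delta_left]
    rw [← ofReal_norm, ← ENNReal.ofReal_pow (norm_nonneg _), norm_mul, Complex.norm_real,
      Real.norm_of_nonneg (Real.exp_pos _).le, mul_pow, ← Real.exp_nat_mul, mul_comm]
    congr 3
    push_cast
    field_simp
  · simp [dampedAmplitude, Set.indicator_of_notMem ht]

theorem measurable_enorm_green (V : Potential) {ε : ℝ} (hε : 0 < ε) (n : ℕ+) :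
    Measurable (fun ξ : ℝ => ‖green V (spectralParam ε ξ) n‖ₑ ^ 2) := by
  have hcont : Continuous (𝓕 (dampedAmplitude V ε n)) :=
    VectorFourier.fourierIntegral_continuous Real.continuous_fourierChar
      (by exact continuous_inner) (integrable_dampedAmplitude V hε n)
  have e : (fun ξ : ℝ => ‖green V (spectralParam ε ξ) n‖ₑ ^ 2)
      = fun ξ => ‖𝓕 (dampedAmplitude V ε n) ξ‖ₑ ^ 2 := by
    ext ξ
    have hI : ‖Complex.I‖ₑ = 1 := by simp [← ofReal_norm]
    rw [fourier_dampedAmplitude V hε, enorm_mul, enorm_neg, hI, one_mul]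
  rw [e]
  exact (hcont.measurable.enorm).pow_const 2

theorem tsum_enorm_sq (ψ : Ell2) : ∑' n, ‖ψ n‖ₑ ^ 2 = ‖ψ‖ₑ ^ 2 := by
  have h := lp.hasSum_norm toReal_two_pos ψ
  simp only [ENNReal.toReal_ofNat, Real.rpow_ofNat] at h
  rw [← ofReal_norm, ← ENNReal.ofReal_pow (norm_nonneg _), ← h.tsum_eq,
    ENNReal.ofReal_tsum_of_nonneg (fun n => by positivity) h.summable]
  refine tsum_congr fun n => ?_
  rw [← ofReal_norm, ← ENNReal.ofReal_pow (norm_nonneg _)]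

theorem shiftLeft_pow_apply (q : ℕ) (ψ : Ell2) (n : ℕ+) :
    (shiftLeft ^ q) ψ n = ψ ⟨n + q, by positivity⟩ := by
  induction q generalizing n with
  | zero => rfl
  | succ q ih =>
    rw [pow_succ', mul_apply_eq_comp, shiftLeft_apply, ih]
    exact congrArg ψ (PNat.eq (by change (n : ℕ) + 1 + q = n + (q + 1); omega))

theorem norm_shiftLeft_le (ψ : Ell2) : ‖shiftLeft ψ‖ ≤ ‖ψ‖ :=
  lp.norm_le_of_forall_sum_le toReal_two_pos (norm_nonneg ψ) (sum_shift_left_le ψ)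

theorem norm_shiftLeft_pow_le (q : ℕ) (ψ : Ell2) : ‖(shiftLeft ^ q) ψ‖ ≤ ‖ψ‖ := by
  induction q with
  | zero => simp
  | succ q ih =>
    rw [pow_succ', mul_apply_eq_comp]
    exact (norm_shiftLeft_le _).trans ih

theorem tsum_enorm_tail (q : ℕ) (ψ : Ell2) :
    ∑' n : {n : ℕ+ // q < (n : ℕ)}, ‖ψ n.1‖ₑ ^ 2 = ‖(shiftLeft ^ q) ψ‖ₑ ^ 2 := by
  rw [← tsum_enorm_sq]
  let e : ℕ+ ≃ {n : ℕ+ // q < (n : ℕ)} :=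
    { toFun := fun n => ⟨⟨n + q, by positivity⟩, by simp⟩
      invFun := fun n => ⟨n.1 - q, Nat.sub_pos_of_lt n.2⟩
      left_inv := fun n => PNat.eq (by simp)
      right_inv := fun n => Subtype.ext (PNat.eq (by
        have := n.2
        simp only [PNat.mk_coe]
        omega)) }
  rw [← e.tsum_eq]
  refine tsum_congr fun n => ?_
  rw [shiftLeft_pow_apply]
  rfl

/-- The outside probability in terms of the Green's function. -/
theorem outsideProbability_eq (V : Potential) (q : ℕ) {T : ℝ} (hT : 0 < T) :
    outsideProbability V q T = ENNReal.ofReal (2 / T) *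
      ∫⁻ ξ : ℝ, ‖(shiftLeft ^ q) (green V (spectralParam T⁻¹ ξ))‖ₑ ^ 2 := by
  simp only [outsideProbability, lintegral_evolution_eq V hT]
  rw [ENNReal.tsum_mul_left]
  have hm : ∀ n : {n : ℕ+ // q < (n : ℕ)},
      AEMeasurable (fun ξ : ℝ => ‖green V (spectralParam T⁻¹ ξ) n.1‖ₑ ^ 2) volume :=
    fun n => (measurable_enorm_green V (inv_pos.2 hT) n.1).aemeasurable
  have h := lintegral_tsum hm
  rw [← h]
  simp only [tsum_enorm_tail]

/-- Plancherel read backwards: summed over all sites, unitarity reduces the time integral to that of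
`e^{-2t/T}`, which is `T/2`. -/
theorem lintegral_norm_green (V : Potential) {T : ℝ} (hT : 0 < T) :
    ENNReal.ofReal (2 / T) * ∫⁻ ξ : ℝ, ‖green V (spectralParam T⁻¹ ξ)‖ₑ ^ 2 = 1 := by
  simp only [← tsum_enorm_sq]
  rw [lintegral_tsum (fun n => (measurable_enorm_green V (inv_pos.2 hT) n).aemeasurable)]
  rw [tsum_congr fun n => (lintegral_evolution_eq V hT n).symm, ← lintegral_tsum]
  · have h1 : ∀ t : ℝ, ∑' n : ℕ+, ENNReal.ofReal
        (‖inner ℂ (delta n) (evolution V t (delta 1))‖ ^ 2 * Real.exp (-2 * t / T))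
        = ENNReal.ofReal (Real.exp (-2 / T * t)) := by
      intro t
      have e : ∀ n : ℕ+, ENNReal.ofReal
          (‖inner ℂ (delta n) (evolution V t (delta 1))‖ ^ 2 * Real.exp (-2 * t / T))
          = ‖evolution V t (delta 1) n‖ₑ ^ 2 * ENNReal.ofReal (Real.exp (-2 / T * t)) := by
        intro n
        rw [ENNReal.ofReal_mul (by positivity), inner_delta_left, ENNReal.ofReal_pow
          (norm_nonneg _), ofReal_norm]
        congr 3
        ring
      simp only [e]
      rw [ENNReal.tsum_mul_right, tsum_enorm_sq, ← ofReal_norm, norm_evolution, norm_delta]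
      simp
    simp only [h1]
    have hneg : -2 / T < 0 := div_neg_of_neg_of_pos (by norm_num) hT
    rw [← ofReal_integral_eq_lintegral_ofReal (integrableOn_exp_mul_Ioi hneg 0)
      (Eventually.of_forall fun t => (Real.exp_pos _).le), integral_exp_mul_Ioi hneg,
      ← ENNReal.ofReal_mul (by positivity)]
    rw [mul_zero, Real.exp_zero]
    have : 2 / T * (-1 / (-2 / T)) = 1 := by field_simp
    rw [this, ENNReal.ofReal_one]
  · intro n
    have := continuous_evolution_apply V (delta 1) n
    simp only [inner_delta_left]
    exact Measurable.aemeasurable (by fun_prop)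

end Dynamics

/-! ### Dependence of the characteristic determinant on the corner entries. -/

open Matrix in
-- Expansion along the replaced row leaves a triangular minor with diagonal `-1`, whose sign cancels
-- the cofactor sign.
theorem det_updateRow_zero_single {m : ℕ} (A : Matrix (Fin (m + 2)) (Fin (m + 2)) ℂ)
    (hsub : ∀ i : Fin (m + 1), A i.succ i.castSucc = -1)
    (hlow : ∀ i j : Fin (m + 2), (j : ℕ) + 1 < i → A i j = 0) :
    (A.updateRow 0 (Pi.single (Fin.last (m + 1)) 1)).det = 1 := by
  rw [det_succ_row_zero, Finset.sum_eq_single (Fin.last (m + 1))]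
  · have e : (A.updateRow 0 (Pi.single (Fin.last (m + 1)) 1)).submatrix Fin.succ
        (Fin.last (m + 1)).succAbove = A.submatrix Fin.succ Fin.castSucc := by
      ext i j
      simp [Fin.succAbove_last]
    rw [e, det_of_isUpperTriangular]
    · simp [hsub, ← mul_pow]
    · intro i j hij
      refine hlow _ _ ?_
      simpa using hij
  · intro j _ hj
    simp [hj]
  · simp

open Matrix in
theorem det_updateRow_last_single {m : ℕ} (A : Matrix (Fin (m + 2)) (Fin (m + 2)) ℂ)
    (hsup : ∀ i : Fin (m + 1), A i.castSucc i.succ = -1)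
    (hup : ∀ i j : Fin (m + 2), (i : ℕ) + 1 < j → A i j = 0) :
    (A.updateRow (Fin.last (m + 1)) (Pi.single 0 1)).det = 1 := by
  rw [det_succ_row _ (Fin.last (m + 1)), Finset.sum_eq_single 0]
  · have e : (A.updateRow (Fin.last (m + 1)) (Pi.single 0 1)).submatrix
        (Fin.last (m + 1)).succAbove (Fin.succAbove 0) = A.submatrix Fin.castSucc Fin.succ := by
      ext i j
      simp [Fin.succAbove_last, Fin.castSucc_ne_last]
    rw [e, det_of_isLowerTriangular]
    · simp [hsup, ← mul_pow]
    · intro i j hij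
      refine hup _ _ ?_
      simpa using hij
  · intro j _ hj
    simp [hj]
  · simp

open Matrix in
/-- The determinant of a tridiagonal matrix as a function of its two corner entries. -/
theorem exists_det_add_corners {m : ℕ} (A : Matrix (Fin (m + 2)) (Fin (m + 2)) ℂ)
    (hsub : ∀ i : Fin (m + 1), A i.succ i.castSucc = -1)
    (hlow : ∀ i j : Fin (m + 2), (j : ℕ) + 1 < i → A i j = 0)
    (hsup : ∀ i : Fin (m + 1), A i.castSucc i.succ = -1)
    (hup : ∀ i j : Fin (m + 2), (i : ℕ) + 1 < j → A i j = 0) :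
    ∃ c d : ℂ, ∀ a b : ℂ,
      (A + single 0 (Fin.last (m + 1)) a + single (Fin.last (m + 1)) 0 b).det
        = c + a + b + a * b * d := by
  -- The determinant is linear in the first and the last row separately; `d` is the term with both
  -- rows replaced.
  refine ⟨A.det, ((A.updateRow 0 (Pi.single (Fin.last (m + 1)) 1)).updateRow (Fin.last (m + 1))
    (Pi.single 0 1)).det, fun a b => ?_⟩
  have h0 : (0 : Fin (m + 2)) ≠ Fin.last (m + 1) := (Fin.last_pos).ne
  have e : A + single 0 (Fin.last (m + 1)) a + single (Fin.last (m + 1)) 0 b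
      = (A.updateRow 0 (A 0 + a • Pi.single (Fin.last (m + 1)) 1)).updateRow (Fin.last (m + 1))
        (A (Fin.last (m + 1)) + b • Pi.single 0 1) := by
    ext i j
    rcases eq_or_ne i (Fin.last (m + 1)) with rfl | hi
    · by_cases hj : j = 0
      · simp [hj, h0]
      · simp [hj, h0, Ne.symm hj]
    · rcases eq_or_ne i 0 with rfl | hi0
      · by_cases hj : j = Fin.last (m + 1)
        · simp [hj, h0]
        · simp [hj, h0, h0.symm, Ne.symm hj]
      · simp [hi, hi0, hi.symm, hi0.symm]
  have comm : ∀ x y : Fin (m + 2) → ℂ,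
      (A.updateRow 0 x).updateRow (Fin.last (m + 1)) y
        = (A.updateRow (Fin.last (m + 1)) y).updateRow 0 x :=
    fun x y => updateRow_comm A h0 x y
  rw [e, det_updateRow_add, det_updateRow_smul, comm, det_updateRow_add, det_updateRow_smul,
    comm, det_updateRow_add, det_updateRow_smul, ← comm _ (Pi.single 0 1)]
  have r1 : (A.updateRow (Fin.last (m + 1)) (A (Fin.last (m + 1)))) = A := updateRow_eq_self _ _
  rw [r1, updateRow_eq_self, comm _ (Pi.single 0 1), det_updateRow_zero_single A hsub hlow,
    det_updateRow_last_single A hsup hup]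
  ring

/-- The matrix of `H` on `{1, …, q}` with general corner contributions. -/
def cornerMatrix (V : Potential) (q : ℕ) (a b : ℂ) : Matrix (Fin q) (Fin q) ℂ :=
  Matrix.of fun i j =>
    (if i = j then (V (Nat.succPNat (i : ℕ)) : ℂ) else 0)
      + (if (i : ℕ) + 1 = (j : ℕ) then 1 else 0)
      + (if (j : ℕ) + 1 = (i : ℕ) then 1 else 0)
      + (if (i : ℕ) = 0 ∧ (j : ℕ) + 1 = q then a else 0)
      + (if (j : ℕ) = 0 ∧ (i : ℕ) + 1 = q then b else 0)

theorem truncation_eq_cornerMatrix (V : Potential) (q : ℕ) (k : ℝ) :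
    truncation V q k
      = cornerMatrix V q (Complex.exp (-(Complex.I * k))) (Complex.exp (Complex.I * k)) := rfl

/-- Characteristic determinants for corner entries with product one differ by a constant. -/
theorem exists_det_sub_cornerMatrix (V : Potential) {q : ℕ} (hq : 1 < q) (z : ℂ) :
    ∃ D : ℂ, ∀ a b : ℂ, a * b = 1 →
      (z • (1 : Matrix (Fin q) (Fin q) ℂ) - cornerMatrix V q a b).det = D - a - b := by
  obtain ⟨m, rfl⟩ : ∃ m, q = m + 2 := ⟨q - 2, by omega⟩
  set A : Matrix (Fin (m + 2)) (Fin (m + 2)) ℂ := z • 1 - cornerMatrix V (m + 2) 0 0 with hA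
  have hA' : ∀ i j, A i j = (if i = j then z - V (Nat.succPNat (i : ℕ)) else 0)
      - (if (i : ℕ) + 1 = (j : ℕ) then 1 else 0) - (if (j : ℕ) + 1 = (i : ℕ) then 1 else 0) := by
    intro i j
    simp only [hA, cornerMatrix, Matrix.sub_apply, Matrix.smul_apply, Matrix.one_apply,
      Matrix.of_apply]
    split_ifs <;> simp <;> ring
  obtain ⟨c, d, h⟩ := exists_det_add_corners A
    (fun i => by
      have h1 : i.succ ≠ i.castSucc := by simp [Fin.ext_iff]
      simp only [hA', if_neg h1]; simp; omega)
    (fun i j hij => by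
      have h1 : i ≠ j := by rintro rfl; omega
      have h2 : ¬ (i : ℕ) + 1 = j := by omega
      have h3 : ¬ (j : ℕ) + 1 = i := by omega
      simp [hA', h1, h2, h3])
    (fun i => by
      have h1 : i.castSucc ≠ i.succ := by simp [Fin.ext_iff]
      simp only [hA', if_neg h1]; simp; omega)
    (fun i j hij => by
      have h1 : i ≠ j := by rintro rfl; omega
      have h2 : ¬ (i : ℕ) + 1 = j := by omega
      have h3 : ¬ (j : ℕ) + 1 = i := by omega
      simp [hA', h1, h2, h3])
  -- With `a * b = 1` the mixed term `a * b * d` is the constant `d`.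
  refine ⟨c + d, fun a b hab => ?_⟩
  have e : z • (1 : Matrix (Fin (m + 2)) (Fin (m + 2)) ℂ) - cornerMatrix V (m + 2) a b
      = A + Matrix.single 0 (Fin.last (m + 1)) (-a) + Matrix.single (Fin.last (m + 1)) 0 (-b) := by
    ext i j
    simp only [hA, cornerMatrix, Matrix.sub_apply, Matrix.add_apply, Matrix.single_apply,
      Matrix.of_apply]
    have e1 : (0 = i ∧ Fin.last (m + 1) = j) ↔ ((i : ℕ) = 0 ∧ (j : ℕ) + 1 = m + 2) := by
      simp only [Fin.ext_iff, Fin.val_zero, Fin.val_last]; omega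
    have e2 : (Fin.last (m + 1) = i ∧ 0 = j) ↔ ((j : ℕ) = 0 ∧ (i : ℕ) + 1 = m + 2) := by
      simp only [Fin.ext_iff, Fin.val_zero, Fin.val_last]; omega
    simp only [e1, e2]
    split_ifs <;> ring
  rw [e, h]
  linear_combination d * hab

/-! ### Periodization and Floquet theory. -/

/-- The potential obtained by repeating `V₁, …, V_q` periodically. -/
def periodization (V : Potential) (q : ℕ) : Potential :=
  ⟨fun n => V (Nat.succPNat (n.natPred % q)), memℓp_infty ⟨‖V‖, by
    rintro _ ⟨n, rfl⟩
    exact lp.norm_apply_le_norm ENNReal.top_ne_zero V _⟩⟩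

theorem periodization_apply (V : Potential) (q : ℕ) (n : ℕ+) :
    periodization V q n = V (Nat.succPNat (n.natPred % q)) := rfl

theorem periodization_add (V : Potential) (p n : ℕ+) :
    periodization V p (n + p) = periodization V p n := by
  have : (n + p).natPred = n.natPred + p := by
    have h1 := PNat.natPred_add_one (n + p)
    have h2 := PNat.natPred_add_one n
    rw [PNat.add_coe] at h1
    omega
  rw [periodization_apply, periodization_apply, this, Nat.add_mod_right]

theorem periodization_of_le (V : Potential) (p n : ℕ+) (h : n ≤ p) :
    periodization V p n = V n := by
  have h2 := PNat.natPred_add_one n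
  have h3 : (n : ℕ) ≤ p := h
  rw [periodization_apply, Nat.mod_eq_of_lt (by omega), PNat.succPNat_natPred]

theorem shiftLeft_pow_apply_pnat (p : ℕ+) (ψ : Ell2) (n : ℕ+) :
    (shiftLeft ^ (p : ℕ)) ψ n = ψ (n + p) :=
  shiftLeft_pow_apply p ψ n

/-- The shift fails to commute with `H` only at site 1: the left neighbour there is `ψ p` before
truncation and `0` after it. -/
theorem shiftLeft_pow_schrodinger {W : Potential} {p : ℕ+} (hW : ∀ n, W (n + p) = W n)
    (ψ : Ell2) : (shiftLeft ^ (p : ℕ)) (schrodinger W ψ)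
      = schrodinger W ((shiftLeft ^ (p : ℕ)) ψ) + ψ p • delta 1 := by
  ext n
  have h1 : n + p ≠ 1 := by
    intro h
    have := congrArg PNat.val h
    have h2 := n.pos
    have h3 := p.pos
    simp only [PNat.val_ofNat, PNat.add_coe] at this
    omega
  rw [shiftLeft_pow_apply_pnat, schrodinger_apply, lp.coeFn_add, lp.coeFn_smul, Pi.add_apply,
    Pi.smul_apply, schrodinger_apply, delta_apply, if_neg h1, hW]
  simp only [shiftLeft_pow_apply_pnat]
  rw [show n + p + 1 = n + 1 + p from add_right_comm n p 1]
  rcases eq_or_ne n 1 with rfl | hn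
  · have : 1 + p - 1 = p :=
      PNat.eq (by rw [PNat.sub_coe, if_pos (PNat.lt_add_right 1 p)]; simp)
    simp [this]
    ring
  · have hn1 : 1 < n := lt_of_le_of_ne one_le hn.symm
    have : n + p - 1 = n - 1 + p := by
      have e : n = 1 + (n - 1) := (PNat.add_sub_of_lt hn1).symm
      refine PNat.eq ?_
      rw [PNat.sub_coe, if_pos (hn1.trans (PNat.lt_add_right n p)), PNat.add_coe, PNat.add_coe,
        PNat.sub_coe, if_pos hn1]
      have : (1 : ℕ) < n := hn1
      simp only [PNat.val_ofNat]
      omega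
    simp [hn, this]

/-- The Floquet property of the Green's function of a periodic half-line operator. -/
theorem shiftLeft_pow_green {W : Potential} {p : ℕ+} (hW : ∀ n, W (n + p) = W n) {z : ℂ}
    (hz : 0 < z.im) : (shiftLeft ^ (p : ℕ)) (green W z) = -(green W z p) • green W z := by
  refine eq_green_of_schrodinger W hz ?_
  have h := shiftLeft_pow_schrodinger hW (green W z)
  rw [schrodinger_green W hz, map_add, map_smul] at h
  have hd : (shiftLeft ^ (p : ℕ)) (delta 1) = 0 := by
    ext n
    rw [shiftLeft_pow_apply_pnat, delta_apply, if_neg]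
    · rfl
    · intro h
      have := congrArg PNat.val h
      have h2 := n.pos
      have h3 := p.pos
      simp only [PNat.val_ofNat, PNat.add_coe] at this
      omega
  rw [hd, add_zero] at h
  rw [h]
  module

theorem green_ne_zero (V : Potential) {z : ℂ} (hz : 0 < z.im) : green V z ≠ 0 := by
  intro h
  have h1 := schrodinger_green V hz
  rw [h, map_zero, smul_zero, zero_add] at h1
  have := norm_delta 1
  rw [← h1, norm_zero] at this
  exact zero_ne_one this

/-- The Floquet multiplier is an eigenvalue of a contraction. -/
theorem norm_green_apply_le_one {W : Potential} {p : ℕ+} (hW : ∀ n, W (n + p) = W n) {z : ℂ}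
    (hz : 0 < z.im) : ‖green W z p‖ ≤ 1 := by
  have h := norm_shiftLeft_pow_le p (green W z)
  rw [shiftLeft_pow_green hW hz, norm_smul, norm_neg] at h
  have hpos : 0 < ‖green W z‖ := norm_pos_iff.2 (green_ne_zero W hz)
  exact le_of_mul_le_mul_right (by linarith) hpos

theorem norm_eq_norm_shiftLeft_pow {ψ : Ell2} {p : ℕ+} (h : ∀ n ≤ p, ψ n = 0) :
    ‖ψ‖ = ‖(shiftLeft ^ (p : ℕ)) ψ‖ := by
  have h1 : ‖ψ‖ₑ ^ 2 = ‖(shiftLeft ^ (p : ℕ)) ψ‖ₑ ^ 2 := by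
    rw [← tsum_enorm_sq, ← tsum_enorm_tail]
    refine (tsum_subtype_eq_of_support_subset (s := {n : ℕ+ | (p : ℕ) < n})
      (f := fun n => ‖ψ n‖ₑ ^ 2) ?_).symm
    intro n hn
    by_contra hc
    have : n ≤ p := by simpa using hc
    exact hn (by simp [h n this])
  rw [← ofReal_norm, ← ofReal_norm, ← ENNReal.ofReal_pow (norm_nonneg _),
    ← ENNReal.ofReal_pow (norm_nonneg _),
    ENNReal.ofReal_eq_ofReal_iff (by positivity) (by positivity)] at h1
  exact (pow_left_inj₀ (norm_nonneg _) (norm_nonneg _) two_ne_zero).1 h1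

/-- Comparison of the Green's functions for potentials that agree on `{1, …, p}`. -/
theorem norm_shiftLeft_pow_green_le (V W : Potential) {p : ℕ+} (hVW : ∀ n ≤ p, W n = V n)
    (hW : ∀ n, |W n| ≤ ‖V‖) {z : ℂ} (hz : 0 < z.im) :
    ‖(shiftLeft ^ (p : ℕ)) (green V z)‖
      ≤ (1 + 2 * ‖V‖ / z.im) * ‖(shiftLeft ^ (p : ℕ)) (green W z)‖ := by
  set u := green V z
  set v := green W z
  set S := shiftLeft ^ (p : ℕ)
  set ψ := mulPotential W v - mulPotential V v with hψ
  have hψapp : ∀ n, ψ n = ((W n : ℂ) - V n) * v n := by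
    intro n
    rw [hψ, lp.coeFn_sub, Pi.sub_apply, mulPotential_apply, mulPotential_apply]
    ring
  -- Resolvent identity; the source `ψ = (W - V) v` vanishes on `{1, …, p}`, so it is controlled by
  -- `S v` alone.
  have e1 : schrodinger V (v - u) - z • (v - u) = -ψ := by
    have h1 : schrodinger V v = schrodinger W v - ψ := by
      simp only [hψ, schrodinger, add_apply]
      abel
    rw [map_sub, h1, schrodinger_green V hz, schrodinger_green W hz]
    module
  have h2 := im_mul_norm_le V z (v - u)
  rw [e1, norm_neg] at h2
  have h3 : ‖ψ‖ ≤ 2 * ‖V‖ * ‖S v‖ := by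
    rw [norm_eq_norm_shiftLeft_pow (p := p) (ψ := ψ)
      (fun n hn => by rw [hψapp, hVW n hn]; simp)]
    have h4 : ‖S ψ‖ ≤ ‖((2 * ‖V‖ : ℝ) : ℂ) • S v‖ := by
      refine lp.norm_mono two_ne_zero fun n => ?_
      rw [lp.coeFn_smul, Pi.smul_apply, shiftLeft_pow_apply_pnat, shiftLeft_pow_apply_pnat,
        hψapp, norm_smul, norm_mul]
      refine mul_le_mul_of_nonneg_right ?_ (norm_nonneg _)
      rw [Complex.norm_real, Real.norm_of_nonneg (by positivity), ← Complex.ofReal_sub,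
        Complex.norm_real]
      have h5 : ‖V (n + p)‖ ≤ ‖V‖ := lp.norm_apply_le_norm ENNReal.top_ne_zero V _
      have h6 : ‖W (n + p)‖ ≤ ‖V‖ := hW (n + p)
      exact (norm_sub_le _ _).trans (by linarith)
    rwa [norm_smul, Complex.norm_real, Real.norm_of_nonneg (by positivity)] at h4
  have h4 : ‖v - u‖ ≤ 2 * ‖V‖ / z.im * ‖S v‖ := by
    rw [div_mul_eq_mul_div, le_div_iff₀ hz]
    linarith
  have h5 : ‖S (v - u)‖ ≤ ‖v - u‖ := norm_shiftLeft_pow_le _ _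
  have h6 : S u = S v - S (v - u) := by rw [← map_sub]; congr 1; abel
  rw [h6]
  refine (norm_sub_le _ _).trans ?_
  linarith

/-- The Floquet multiplier of the periodic Green's function is a characteristic value of the
truncated matrix with the corresponding corner contributions. -/
theorem det_sub_cornerMatrix_green (V : Potential) {q : ℕ} (hq : 1 < q) {p : ℕ+} (hp : (p : ℕ) = q)
    {z : ℂ} (hz : 0 < z.im) {μ : ℂ} (hμ : μ = -(green (periodization V q) z p)) (hμ0 : μ ≠ 0) :
    (z • (1 : Matrix (Fin q) (Fin q) ℂ) - cornerMatrix V q μ⁻¹ μ).det = 0 := by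
  subst hp
  set W := periodization V p
  set v := green W z with hv
  have hH : ∀ n : ℕ+, v (n + 1) + (if n = 1 then 0 else v (n - 1)) + (W n : ℂ) * v n
      = z * v n + if n = 1 then 1 else 0 := by
    intro n
    have h := congrArg (fun ψ : Ell2 => ψ n) (schrodinger_green W hz)
    simpa only [schrodinger_apply, lp.coeFn_add, lp.coeFn_smul, Pi.add_apply, Pi.smul_apply,
      smul_eq_mul, delta_apply] using h
  have hfl : ∀ n : ℕ+, v (n + p) = μ * v n := by
    intro n
    have h := congrArg (fun ψ : Ell2 => ψ n)
      (shiftLeft_pow_green (periodization_add V p) hz : _ = -(v p) • v)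
    simp only [shiftLeft_pow_apply_pnat, lp.coeFn_smul, Pi.smul_apply, smul_eq_mul] at h
    rw [hμ]
    exact h
  set w : Fin p → ℂ := fun j => v (Nat.succPNat j) with hw
  refine Matrix.exists_mulVec_eq_zero_iff.1 ⟨w, ?_, ?_⟩
  · intro h0
    -- If `v` vanished at sites 1 and 2, the equation at site 1 would read `0 = 1`.
    have h1 : v 1 = 0 := congrFun h0 ⟨0, by omega⟩
    have h2 : v 2 = 0 := congrFun h0 ⟨1, by omega⟩
    have h := hH 1
    rw [show (1 : ℕ+) + 1 = 2 from rfl, h1, h2] at h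
    simp at h
  · ext i
    rw [Matrix.sub_mulVec, Pi.sub_apply, Matrix.smul_mulVec, Matrix.one_mulVec, Pi.smul_apply,
      smul_eq_mul, Pi.zero_apply, sub_eq_zero]
    have hWi : W (Nat.succPNat i) = V (Nat.succPNat i) :=
      periodization_of_le V p _ (by
        rw [← PNat.coe_le_coe, Nat.succPNat_coe]; exact i.2)
    have hi := hH (Nat.succPNat i)
    rw [hWi] at hi
    have e : (cornerMatrix V p μ⁻¹ μ).mulVec w i
        = (V (Nat.succPNat i) : ℂ) * w i + (∑ j : Fin p, if (i : ℕ) + 1 = (j : ℕ) then w j else 0)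
          + (∑ j : Fin p, if (j : ℕ) + 1 = i then w j else 0)
          + (∑ j : Fin p, if (i : ℕ) = 0 ∧ (j : ℕ) + 1 = p then μ⁻¹ * w j else 0)
          + (∑ j : Fin p, if (j : ℕ) = 0 ∧ (i : ℕ) + 1 = p then μ * w j else 0) := by
      simp only [Matrix.mulVec, dotProduct, cornerMatrix, Matrix.of_apply, add_mul, ite_mul,
        zero_mul, one_mul, Finset.sum_add_distrib]
      congr 4
      rw [Finset.sum_ite_eq Finset.univ i]
      simp
    have s1 : (∑ j : Fin p, if (i : ℕ) + 1 = j then w j else 0)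
        + (∑ j : Fin p, if (j : ℕ) = 0 ∧ (i : ℕ) + 1 = p then μ * w j else 0)
        = v (Nat.succPNat i + 1) := by
      by_cases h : (i : ℕ) + 1 < p
      · rw [Finset.sum_eq_single_of_mem (⟨i + 1, h⟩ : Fin p) (Finset.mem_univ _),
          Finset.sum_eq_zero]
        · simp only [if_true, add_zero, hw]
          rfl
        · intro j _
          rw [if_neg]
          omega
        · intro j _ hj
          rw [if_neg]
          intro h'
          exact hj (Fin.ext h'.symm)
      · have hip : (i : ℕ) + 1 = p := by have := i.2; omega
        rw [Finset.sum_eq_zero, Finset.sum_eq_single_of_mem (⟨0, by omega⟩ : Fin p)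
          (Finset.mem_univ _)]
        · simp only [hip, and_self, if_true, zero_add, hw]
          have e1 : Nat.succPNat i = p := PNat.eq (by rw [Nat.succPNat_coe]; exact hip)
          rw [e1, add_comm p 1, hfl]
          rfl
        · intro j _ hj
          rw [if_neg]
          rintro ⟨h', -⟩
          exact hj (Fin.ext h')
        · intro j _
          rw [if_neg]
          have := j.2
          omega
    -- Since `v p = -μ`, the corner term `μ⁻¹ * v p = -1` reproduces the source `δ₁`, turning the
    -- inhomogeneous equation into an eigenvalue equation.
    have s2 : (∑ j : Fin p, if (j : ℕ) + 1 = i then w j else 0)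
        + (∑ j : Fin p, if (i : ℕ) = 0 ∧ (j : ℕ) + 1 = p then μ⁻¹ * w j else 0)
        = (if Nat.succPNat i = 1 then 0 else v (Nat.succPNat i - 1))
          - if Nat.succPNat i = 1 then 1 else 0 := by
      by_cases h : (i : ℕ) = 0
      · have e1 : Nat.succPNat i = 1 := PNat.eq (by rw [Nat.succPNat_coe, h]; rfl)
        rw [Finset.sum_eq_zero, Finset.sum_eq_single_of_mem (⟨p - 1, by omega⟩ : Fin p)
          (Finset.mem_univ _)]
        · have h1 : (p : ℕ) - 1 + 1 = p := by omega
          have e2 : Nat.succPNat (p - 1) = p := PNat.eq (by rw [Nat.succPNat_coe]; exact h1)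
          have e3 : v p = -μ := by rw [hμ, neg_neg]
          rw [if_pos e1, if_pos e1]
          simp only [h, h1, and_self, if_true, hw, e2, e3]
          field_simp
          ring
        · intro j _ hj
          rw [if_neg]
          rintro ⟨-, h'⟩
          exact hj (Fin.ext (by simp only; omega))
        · intro j _
          rw [if_neg]
          omega
      · have e1 : Nat.succPNat i ≠ 1 := by
          intro h'
          have := congrArg PNat.val h'
          change (i : ℕ) + 1 = 1 at this
          omega
        have hlt : (i : ℕ) - 1 < p := by omega
        rw [Finset.sum_eq_single_of_mem (⟨(i : ℕ) - 1, hlt⟩ : Fin p) (Finset.mem_univ _),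
          Finset.sum_eq_zero]
        · have h1 : (i : ℕ) - 1 + 1 = i := by omega
          have h2 : Nat.succPNat i - 1 = Nat.succPNat (i - 1) := by
            refine PNat.eq ?_
            rw [PNat.sub_coe, if_pos (lt_of_le_of_ne one_le e1.symm)]
            change (i : ℕ) + 1 - 1 = i - 1 + 1
            omega
          simp only [h1, if_true, if_neg e1, h2, hw, add_zero, sub_zero]
        · intro j _
          rw [if_neg]
          omega
        · intro j _ hj
          rw [if_neg]
          intro h'
          exact hj (Fin.ext (by simp only; omega))
    rw [e]
    have hwi : w i = v (Nat.succPNat i) := rfl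
    rw [hwi]
    linear_combination -hi - s1 - s2

/-! ### Estimates for real-rooted polynomials. -/

/-- Some zero `x j` of a real-rooted polynomial next to `E` has derivative at most `e` times the
value of the deflated polynomial at `E`. -/
theorem exists_prod_abs_sub_le {ι : Type*} [Fintype ι] [DecidableEq ι] [Nonempty ι] (x : ι → ℝ)
    (E : ℝ) : ∃ j, ∏ i ∈ Finset.univ.erase j, |x j - x i|
      ≤ Real.exp 1 * ∏ i ∈ Finset.univ.erase j, |E - x i| := by
  by_cases hE : ∃ j, E = x j
  · obtain ⟨j, rfl⟩ := hE
    exact ⟨j, le_mul_of_one_le_left (Finset.prod_nonneg fun i _ => abs_nonneg _)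
      (Real.one_le_exp zero_le_one)⟩
  push Not at hE
  have key : ∀ (y : ι → ℝ) (F : ℝ), (∀ j, F ≠ y j) → 0 ≤ ∑ i, (F - y i)⁻¹ →
      ∃ j, ∏ i ∈ Finset.univ.erase j, |y j - y i|
        ≤ Real.exp 1 * ∏ i ∈ Finset.univ.erase j, |F - y i| := by
    intro y F hF hs
    have hne : (Finset.univ.filter fun i => y i < F).Nonempty := by
      by_contra hc
      rw [Finset.not_nonempty_iff_eq_empty, Finset.filter_eq_empty_iff] at hc
      have : ∑ i, (F - y i)⁻¹ < 0 :=
        Finset.sum_neg (fun i _ => inv_lt_zero.2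
          (sub_neg.2 (lt_of_le_of_ne (not_lt.1 (hc (Finset.mem_univ i))) (hF i))))
          Finset.univ_nonempty
      linarith
    -- The zero nearest to `F` on its left. This makes each ratio `(y j - y i) / (F - y i) = 1 - (F
    -- - y j) / (F - y i)` nonnegative, so `1 - s ≤ exp (-s)` applies to its absolute value.
    obtain ⟨j, hj, hmax⟩ := Finset.exists_max_image _ y hne
    have hjF : y j < F := (Finset.mem_filter.1 hj).2
    have hL : 0 < F - y j := sub_pos.2 hjF
    refine ⟨j, ?_⟩
    have hterm : ∀ i ∈ Finset.univ.erase j,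
        |y j - y i| ≤ |F - y i| * Real.exp (-((F - y j) * (F - y i)⁻¹)) := by
      intro i _
      have hne0 : F - y i ≠ 0 := sub_ne_zero.2 (hF i)
      have e : y j - y i = (F - y i) * (1 - (F - y j) * (F - y i)⁻¹) := by
        field_simp
        ring
      rw [e, abs_mul]
      refine mul_le_mul_of_nonneg_left ?_ (abs_nonneg _)
      have hnn : 0 ≤ 1 - (F - y j) * (F - y i)⁻¹ := by
        rcases lt_or_gt_of_ne (hF i) with h | h
        · have : (F - y i)⁻¹ < 0 := inv_lt_zero.2 (sub_neg.2 h)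
          nlinarith
        · have h1 := hmax i (Finset.mem_filter.2 ⟨Finset.mem_univ i, h⟩)
          rw [sub_nonneg, ← div_eq_mul_inv, div_le_one (sub_pos.2 h)]
          linarith
      rw [abs_of_nonneg hnn]
      have := Real.add_one_le_exp (-((F - y j) * (F - y i)⁻¹))
      linarith
    calc ∏ i ∈ Finset.univ.erase j, |y j - y i|
        ≤ ∏ i ∈ Finset.univ.erase j, (|F - y i| * Real.exp (-((F - y j) * (F - y i)⁻¹))) :=
          Finset.prod_le_prod (fun i _ => abs_nonneg _) hterm
      _ = Real.exp (-((F - y j) * ∑ i ∈ Finset.univ.erase j, (F - y i)⁻¹))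
          * ∏ i ∈ Finset.univ.erase j, |F - y i| := by
          rw [Finset.prod_mul_distrib, ← Real.exp_sum, Finset.sum_neg_distrib, Finset.mul_sum,
            mul_comm]
      _ ≤ _ := by
          -- The full logarithmic derivative is nonnegative, and omitting its `j`-th term costs
          -- exactly 1 in the exponent.
          refine mul_le_mul_of_nonneg_right (Real.exp_le_exp.2 ?_)
            (Finset.prod_nonneg fun i _ => abs_nonneg _)
          have h1 := Finset.add_sum_erase Finset.univ (fun i => (F - y i)⁻¹) (Finset.mem_univ j)
          have h2 : (F - y j) * (F - y j)⁻¹ = 1 := mul_inv_cancel₀ hL.ne'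
          have h3 : 0 ≤ (F - y j) * ∑ i, (F - y i)⁻¹ := mul_nonneg hL.le hs
          rw [← h1, mul_add, h2] at h3
          linarith
  rcases le_total 0 (∑ i, (E - x i)⁻¹) with hs | hs
  · exact key x E hE hs
  -- Reflection flips the sign of the logarithmic derivative.
  · obtain ⟨j, hj⟩ := key (fun i => -x i) (-E) (fun j h => hE j (neg_injective h)) (by
      have : ∑ i, (-E - -x i)⁻¹ = -∑ i, (E - x i)⁻¹ := by
        rw [← Finset.sum_neg_distrib]
        refine Finset.sum_congr rfl fun i _ => ?_
        rw [← inv_neg]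
        congr 1
        ring
      rw [this]
      linarith)
    refine ⟨j, ?_⟩
    have e : ∀ a b : ℝ, |-a - -b| = |a - b| := fun a b => by rw [neg_sub_neg, abs_sub_comm]
    simpa only [e] using hj

/-- Moving off the real axis increases the modulus of a real-rooted polynomial. -/
theorem one_add_mul_prod_sq_le {ι : Type*} [Fintype ι] [DecidableEq ι] (a : ι → ℝ) (y η : ℝ)
    (j : ι) (hj : y ≠ a j) :
    (1 + η ^ 2 / (y - a j) ^ 2) * ‖∏ i, ((y : ℂ) - a i)‖ ^ 2
      ≤ ‖∏ i, ((y : ℂ) + Complex.I * η - a i)‖ ^ 2 := by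
  have h1 : ∀ i, ‖(y : ℂ) + Complex.I * η - a i‖ ^ 2 = (y - a i) ^ 2 + η ^ 2 := by
    intro i
    rw [Complex.sq_norm, Complex.normSq_apply]
    simp
    ring
  have h2 : ∀ i, ‖(y : ℂ) - a i‖ ^ 2 = (y - a i) ^ 2 := by
    intro i
    rw [← Complex.ofReal_sub, Complex.norm_real, Real.norm_eq_abs, sq_abs]
  rw [norm_prod, norm_prod, ← Finset.prod_pow, ← Finset.prod_pow]
  simp only [h1, h2]
  rw [← Finset.mul_prod_erase _ _ (Finset.mem_univ j),
    ← Finset.mul_prod_erase _ (fun i => (y - a i) ^ 2 + η ^ 2) (Finset.mem_univ j), ← mul_assoc]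
  have h3 : (1 + η ^ 2 / (y - a j) ^ 2) * (y - a j) ^ 2 = (y - a j) ^ 2 + η ^ 2 := by
    have : y - a j ≠ 0 := sub_ne_zero.2 hj
    field_simp
  rw [h3]
  refine mul_le_mul_of_nonneg_left ?_ (by positivity)
  exact Finset.prod_le_prod (fun i _ => sq_nonneg _) (fun i _ => by nlinarith [sq_nonneg η])

theorem eight_div_add_sq_le {α β : ℝ} (hα : 0 < α) (hβ : 0 < β) :
    8 / (α + β) ^ 2 ≤ 1 / α ^ 2 + 1 / β ^ 2 := by
  rw [div_add_div _ _ (by positivity) (by positivity), div_le_div_iff₀ (by positivity)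
    (by positivity)]
  nlinarith [sq_nonneg (α - β), sq_nonneg (α ^ 2 - β ^ 2), mul_pos hα hβ,
    mul_nonneg (mul_pos hα hβ).le (sq_nonneg (α - β))]

/-- Lower bound for the derivative of a discriminant `f` at a zero lying between corresponding
zeros of `f - 2` and `f + 2`. -/
theorem four_div_le_prod_abs_sub {ι : Type*} [Fintype ι] [DecidableEq ι] (x a c : ι → ℝ)
    (ha : ∀ z : ℂ, ∏ i, (z - a i) = ∏ i, (z - x i) - 2)
    (hc : ∀ z : ℂ, ∏ i, (z - c i) = ∏ i, (z - x i) + 2) (j : ι)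
    (hj : |x j - a j| + |x j - c j| = |c j - a j|) :
    4 / |c j - a j| ≤ ∏ i ∈ Finset.univ.erase j, |x j - x i| := by
  have hx0 : ∏ i, ((x j : ℂ) - x i) = 0 := Finset.prod_eq_zero (Finset.mem_univ j) (sub_self _)
  have hxa : x j ≠ a j := by
    intro h
    have := ha (x j)
    rw [hx0, Finset.prod_eq_zero (Finset.mem_univ j) (by rw [h, sub_self])] at this
    norm_num at this
  have hxc : x j ≠ c j := by
    intro h
    have := hc (x j)
    rw [hx0, Finset.prod_eq_zero (Finset.mem_univ j) (by rw [h, sub_self])] at this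
    norm_num at this
  have hα : 0 < |x j - a j| := abs_pos.2 (sub_ne_zero.2 hxa)
  have hβ : 0 < |x j - c j| := abs_pos.2 (sub_ne_zero.2 hxc)
  have hb : 0 < |c j - a j| := by linarith
  -- At `x j` both `f - 2` and `f + 2` have modulus 2. Raising the point by `η` enlarges their
  -- squares by `1 + η²/α²` and `1 + η²/β²`, where `α + β` is the band width. The parallelogram
  -- identity and `eight_div_add_sq_le` then bound `|f|` below by `4η/(α + β)`; dividing by `η` and
  -- letting `η → 0` gives the claim.
  have main : ∀ η : ℝ, 0 < η →
      4 / |c j - a j| ≤ ∏ i ∈ Finset.univ.erase j, ‖(x j : ℂ) + Complex.I * η - x i‖ := by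
    intro η hη
    set w := ∏ i, ((x j : ℂ) + Complex.I * η - x i) with hw
    have h1 := one_add_mul_prod_sq_le a (x j) η j hxa
    have h2 := one_add_mul_prod_sq_le c (x j) η j hxc
    rw [ha, ha, hx0, ← hw, zero_sub, norm_neg, Complex.norm_ofNat, ← sq_abs (x j - a j)] at h1
    rw [hc, hc, hx0, ← hw, zero_add, Complex.norm_ofNat, ← sq_abs (x j - c j)] at h2
    have h3 : ‖w - 2‖ ^ 2 + ‖w + 2‖ ^ 2 = 2 * ‖w‖ ^ 2 + 8 := by
      simp only [Complex.sq_norm, Complex.normSq_apply]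
      simp
      ring
    have h4 := eight_div_add_sq_le hα hβ
    rw [hj] at h4
    have h5 : (4 / |c j - a j| * η) ^ 2 ≤ ‖w‖ ^ 2 := by
      have e : (4 / |c j - a j| * η) ^ 2 = 2 * η ^ 2 * (8 / |c j - a j| ^ 2) := by ring
      rw [e]
      refine (mul_le_mul_of_nonneg_left h4 (by positivity)).trans ?_
      have e2 : 2 * η ^ 2 * (1 / |x j - a j| ^ 2 + 1 / |x j - c j| ^ 2)
          = 2 * (η ^ 2 / |x j - a j| ^ 2) + 2 * (η ^ 2 / |x j - c j| ^ 2) := by ring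
      rw [e2]
      linarith
    have h6 := (pow_le_pow_iff_left₀ (by positivity) (norm_nonneg _) two_ne_zero).1 h5
    have h7 : ‖w‖ = η * ∏ i ∈ Finset.univ.erase j, ‖(x j : ℂ) + Complex.I * η - x i‖ := by
      rw [hw, norm_prod, ← Finset.mul_prod_erase _ _ (Finset.mem_univ j)]
      congr 1
      rw [add_sub_cancel_left, norm_mul, Complex.norm_I, one_mul, Complex.norm_real,
        Real.norm_of_nonneg hη.le]
    rw [h7, mul_comm] at h6
    exact le_of_mul_le_mul_left h6 hη
  have hcont : Continuous (fun η : ℝ =>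
      ∏ i ∈ Finset.univ.erase j, ‖(x j : ℂ) + Complex.I * η - x i‖) := by fun_prop
  have hlim := (hcont.tendsto 0).mono_left (nhdsWithin_le_nhds (s := Set.Ioi 0))
  have hfin := ge_of_tendsto hlim (Filter.eventually_of_mem self_mem_nhdsWithin main)
  refine hfin.trans_eq (Finset.prod_congr rfl fun i _ => ?_)
  rw [Complex.ofReal_zero, mul_zero, add_zero, ← Complex.ofReal_sub, Complex.norm_real,
    Real.norm_eq_abs]

/-! ### Weyl's inequality. -/

section Weyl

variable {E : Type*} [NormedAddCommGroup E] [InnerProductSpace ℂ E] [FiniteDimensional ℂ E]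

theorem re_inner_apply_eq_sum {S : E →ₗ[ℂ] E} (hS : S.IsSymmetric) {n : ℕ}
    (hn : Module.finrank ℂ E = n) (v : E) :
    (inner ℂ (S v) v).re
      = ∑ j, hS.eigenvalues hn j * ‖inner ℂ (hS.eigenvectorBasis hn j) v‖ ^ 2 := by
  rw [← (hS.eigenvectorBasis hn).sum_inner_mul_inner, Complex.re_sum]
  refine Finset.sum_congr rfl fun j _ => ?_
  rw [hS, hS.apply_eigenvectorBasis, inner_smul_right, ← inner_conj_symm v, mul_assoc,
    RCLike.conj_mul]
  norm_cast

/-- Weyl's inequality for eigenvalues listed in nonincreasing order. -/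
theorem eigenvalues_le_add {S T : E →ₗ[ℂ] E} (hS : S.IsSymmetric) (hT : T.IsSymmetric) {n : ℕ}
    (hn : Module.finrank ℂ E = n) {δ : ℝ}
    (h : ∀ v, (inner ℂ (S v) v).re ≤ (inner ℂ (T v) v).re + δ * ‖v‖ ^ 2) (i : Fin n) :
    hS.eigenvalues hn i ≤ hT.eigenvalues hn i + δ := by
  -- There are only `n - 1` conditions, so some nonzero `v` lies both in the span of the
  -- eigenvectors of `S` with index `≤ i` and in that of the eigenvectors of `T` with index `≥ i`.
  let Φ : E →ₗ[ℂ] ({j : Fin n // j ≠ i} → ℂ) := LinearMap.pi fun j =>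
    if j.1 < i then (innerSL ℂ (hT.eigenvectorBasis hn j.1)).toLinearMap
    else (innerSL ℂ (hS.eigenvectorBasis hn j.1)).toLinearMap
  have hrank : Module.finrank ℂ ({j : Fin n // j ≠ i} → ℂ) < Module.finrank ℂ E := by
    rw [Module.finrank_fintype_fun_eq_card, hn, Fintype.card_subtype_compl, Fintype.card_fin,
      Fintype.card_subtype_eq]
    have := i.pos
    omega
  obtain ⟨v, hv, hv0⟩ := (Submodule.ne_bot_iff _).1 (LinearMap.ker_ne_bot_of_finrank_lt (f := Φ) hrank)
  have hΦ : ∀ j : {j : Fin n // j ≠ i}, Φ v j = 0 := fun j => congrFun (LinearMap.mem_ker.1 hv) j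
  have hTv : ∀ j, j < i → inner ℂ (hT.eigenvectorBasis hn j) v = 0 := by
    intro j hj
    have := hΦ ⟨j, hj.ne⟩
    simpa [Φ, hj] using this
  have hSv : ∀ j, i < j → inner ℂ (hS.eigenvectorBasis hn j) v = 0 := by
    intro j hj
    have := hΦ ⟨j, hj.ne'⟩
    simpa [Φ, hj.not_gt] using this
  have h1 : hS.eigenvalues hn i * ‖v‖ ^ 2 ≤ (inner ℂ (S v) v).re := by
    rw [re_inner_apply_eq_sum hS hn, ← (hS.eigenvectorBasis hn).sum_sq_norm_inner_right v,
      Finset.mul_sum]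
    refine Finset.sum_le_sum fun j _ => ?_
    rcases lt_or_ge i j with hj | hj
    · simp [hSv j hj]
    · exact mul_le_mul_of_nonneg_right (hS.eigenvalues_antitone hn hj) (by positivity)
  have h2 : (inner ℂ (T v) v).re ≤ hT.eigenvalues hn i * ‖v‖ ^ 2 := by
    rw [re_inner_apply_eq_sum hT hn, ← (hT.eigenvectorBasis hn).sum_sq_norm_inner_right v,
      Finset.mul_sum]
    refine Finset.sum_le_sum fun j _ => ?_
    rcases lt_or_ge j i with hj | hj
    · simp [hTv j hj]
    · exact mul_le_mul_of_nonneg_right (hT.eigenvalues_antitone hn hj) (by positivity)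
  have hpos : 0 < ‖v‖ ^ 2 := by
    have := norm_pos_iff.2 hv0
    positivity
  refine le_of_mul_le_mul_right ?_ hpos
  linarith [h v]

end Weyl

/-! ### Band functions and the discriminant. -/

/-- The truncated operator acting on Euclidean space. -/
def truncationCLM (V : Potential) (q : ℕ) (k : ℝ) :
    EuclideanSpace ℂ (Fin q) →L[ℂ] EuclideanSpace ℂ (Fin q) :=
  Matrix.toEuclideanCLM (n := Fin q) (𝕜 := ℂ) (truncation V q k)

theorem continuous_truncationCLM (V : Potential) (q : ℕ) : Continuous (truncationCLM V q) := by
  have h1 : Continuous (fun A : Matrix (Fin q) (Fin q) ℂ =>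
      Matrix.toEuclideanCLM (n := Fin q) (𝕜 := ℂ) A) :=
    LinearMap.continuous_of_finiteDimensional
      (Matrix.toEuclideanCLM (n := Fin q) (𝕜 := ℂ)).toAlgEquiv.toLinearMap
  refine h1.comp (continuous_matrix fun i j => ?_)
  simp only [truncation, Matrix.of_apply]
  refine (continuous_const.add ?_).add ?_
  · split_ifs <;> fun_prop
  · split_ifs <;> fun_prop

theorem eigenvalue_le_add (V : Potential) (q : ℕ) (k l : ℝ) (j : Fin q) :
    eigenvalue V q k j ≤ eigenvalue V q l j + ‖truncationCLM V q k - truncationCLM V q l‖ := by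
  refine eigenvalues_le_add _ _ _ (fun v => ?_) _
  have e : (inner ℂ (truncationCLM V q k v) v).re = (inner ℂ (truncationCLM V q l v) v).re
      + (inner ℂ ((truncationCLM V q k - truncationCLM V q l) v) v).re := by
    rw [sub_apply, inner_sub_left, Complex.sub_re]
    ring
  refine e.trans_le (add_le_add_right ?_ _)
  refine (Complex.re_le_norm _).trans ((norm_inner_le_norm _ _).trans ?_)
  rw [sq, ← mul_assoc]
  exact mul_le_mul_of_nonneg_right (ContinuousLinearMap.le_opNorm _ _) (norm_nonneg _)

theorem continuous_eigenvalue (V : Potential) (q : ℕ) (j : Fin q) :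
    Continuous (fun k => eigenvalue V q k j) := by
  refine continuous_iff_continuousAt.2 fun l => ?_
  have hc : Filter.Tendsto (fun k => ‖truncationCLM V q k - truncationCLM V q l‖) (nhds l)
      (nhds 0) := by
    have := (((continuous_truncationCLM V q).sub (continuous_const
      (y := truncationCLM V q l))).norm).tendsto l
    simpa using this
  refine tendsto_iff_dist_tendsto_zero.2 (squeeze_zero (fun _ => dist_nonneg) (fun k => ?_) hc)
  rw [Real.dist_eq, abs_le]
  have h1 := eigenvalue_le_add V q k l j
  have h2 := eigenvalue_le_add V q l k j
  rw [norm_sub_rev] at h2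
  constructor <;> linarith

theorem det_sub_truncation (V : Potential) (q : ℕ) (k : ℝ) (z : ℂ) :
    (z • (1 : Matrix (Fin q) (Fin q) ℂ) - truncation V q k).det
      = ∏ j, (z - eigenvalue V q k j) := by
  have h1 : (truncation V q k).charpoly.eval z
      = (z • (1 : Matrix (Fin q) (Fin q) ℂ) - truncation V q k).det := by
    rw [Matrix.eval_charpoly, Matrix.scalar_apply, ← Matrix.smul_one_eq_diagonal]
  have h2 := (truncation_isHermitian V q k).splits_charpoly.eq_prod_roots_of_monic
    (Matrix.charpoly_monic _)
  rw [← h1, h2, roots_charpoly_truncation, Multiset.map_map, Polynomial.eval_multiset_prod,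
    Multiset.map_map]
  simp [Finset.prod]

/-- The discriminant of the truncated operator. -/
def discriminant (V : Potential) (q : ℕ) (z : ℂ) : ℂ :=
  ∏ j, (z - eigenvalue V q (Real.pi / 2) j)

/-- At `k = π/2` the corners are `-i` and `i`, with sum zero; this identifies the constant `D` with
`discriminant`. -/
theorem det_sub_cornerMatrix (V : Potential) {q : ℕ} (hq : 1 < q) (z : ℂ) {a b : ℂ}
    (hab : a * b = 1) :
    (z • (1 : Matrix (Fin q) (Fin q) ℂ) - cornerMatrix V q a b).det
      = discriminant V q z - a - b := by
  obtain ⟨D, hD⟩ := exists_det_sub_cornerMatrix V hq z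
  have h1 := hD (Complex.exp (-(Complex.I * (Real.pi / 2 : ℝ))))
    (Complex.exp (Complex.I * (Real.pi / 2 : ℝ))) (by rw [← Complex.exp_add]; simp)
  rw [← truncation_eq_cornerMatrix, det_sub_truncation] at h1
  have e1 : Complex.exp (Complex.I * (Real.pi / 2 : ℝ)) = Complex.I := by
    rw [mul_comm]; push_cast; exact Complex.exp_pi_div_two_mul_I
  rw [Complex.exp_neg, e1, Complex.inv_I] at h1
  rw [hD a b hab, discriminant, h1]
  ring

theorem prod_sub_eigenvalue (V : Potential) {q : ℕ} (hq : 1 < q) (k : ℝ) (z : ℂ) :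
    ∏ j, (z - eigenvalue V q k j) = discriminant V q z - 2 * Real.cos k := by
  rw [← det_sub_truncation, truncation_eq_cornerMatrix,
    det_sub_cornerMatrix V hq z (by rw [← Complex.exp_add]; simp), Complex.ofReal_cos,
    Complex.two_cos]
  ring_nf

theorem discriminant_eigenvalue (V : Potential) {q : ℕ} (hq : 1 < q) (k : ℝ) (j : Fin q) :
    discriminant V q (eigenvalue V q k j) = 2 * Real.cos k := by
  have h := prod_sub_eigenvalue V hq k (eigenvalue V q k j)
  rw [Finset.prod_eq_zero (Finset.mem_univ j) (sub_self _)] at h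
  exact (sub_eq_zero.1 h.symm)

/-- The discriminant equals `2 cos k` at `E_j(k)`, so `E_j` is injective on `[0, π]`; being
continuous it is strictly monotone, and `E_j(π/2)` lies between the band edges. -/
theorem abs_sub_add_abs_sub_eq_bandWidth (V : Potential) {q : ℕ} (hq : 1 < q) (j : Fin q) :
    |eigenvalue V q (Real.pi / 2) j - eigenvalue V q 0 j|
      + |eigenvalue V q (Real.pi / 2) j - eigenvalue V q Real.pi j| = bandWidth V q j := by
  have hinj : Set.InjOn (fun k => eigenvalue V q k j) (Set.Icc 0 Real.pi) := by
    intro k hk l hl hkl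
    have h1 := discriminant_eigenvalue V hq k j
    have h2 := discriminant_eigenvalue V hq l j
    simp only at hkl
    rw [hkl, h2] at h1
    refine Real.injOn_cos hk hl ?_
    exact_mod_cast (mul_left_cancel₀ two_ne_zero h1).symm
  have hpi := Real.pi_pos
  have m0 : (0 : ℝ) ∈ Set.Icc 0 Real.pi := ⟨le_rfl, hpi.le⟩
  have m1 : Real.pi / 2 ∈ Set.Icc 0 Real.pi := ⟨by linarith, by linarith⟩
  have m2 : Real.pi ∈ Set.Icc 0 Real.pi := ⟨hpi.le, le_rfl⟩
  rcases (continuous_eigenvalue V q j).continuousOn.strictMonoOn_of_injOn_Icc' hpi.le hinj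
    with h | h
  · have h1 := h m0 m1 (by linarith)
    have h2 := h m1 m2 (by linarith)
    simp only at h1 h2
    rw [bandWidth, abs_of_pos (by linarith), abs_of_neg (by linarith), abs_of_pos (by linarith)]
    ring
  · have h1 := h m0 m1 (by linarith)
    have h2 := h m1 m2 (by linarith)
    simp only at h1 h2
    rw [bandWidth, abs_of_neg (by linarith), abs_of_pos (by linarith), abs_of_neg (by linarith)]
    ring

theorem bandWidth_pos (V : Potential) {q : ℕ} (hq : 1 < q) (j : Fin q) : 0 < bandWidth V q j := by
  refine abs_pos.2 (sub_ne_zero.2 fun h => ?_)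
  have h1 := discriminant_eigenvalue V hq Real.pi j
  rw [h, discriminant_eigenvalue V hq 0 j] at h1
  norm_num at h1

theorem four_div_bandWidth_le (V : Potential) {q : ℕ} (hq : 1 < q) (j : Fin q) :
    4 / bandWidth V q j ≤ ∏ i ∈ Finset.univ.erase j,
      |eigenvalue V q (Real.pi / 2) j - eigenvalue V q (Real.pi / 2) i| := by
  refine four_div_le_prod_abs_sub (eigenvalue V q (Real.pi / 2)) (eigenvalue V q 0)
    (eigenvalue V q Real.pi) (fun z => ?_) (fun z => ?_) j
    (abs_sub_add_abs_sub_eq_bandWidth V hq j)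
  · rw [prod_sub_eigenvalue V hq, discriminant]
    simp
  · rw [prod_sub_eigenvalue V hq, discriminant]
    simp

/-! ### Bounding the Floquet multiplier. -/

/-- Off the real axis the discriminant is large if all bands are small. -/
theorem le_norm_discriminant (V : Potential) {q : ℕ} (hq : 1 < q) {b : ℝ}
    (hb : ∀ j, bandWidth V q j ≤ b) {z : ℂ} (hz : 0 < z.im) :
    4 * z.im / (Real.exp 1 * b) ≤ ‖discriminant V q z‖ := by
  have : Nonempty (Fin q) := ⟨⟨0, by omega⟩⟩
  obtain ⟨j, hj⟩ := exists_prod_abs_sub_le (eigenvalue V q (Real.pi / 2)) z.re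
  have h1 := (four_div_bandWidth_le V hq j).trans hj
  have hbj := bandWidth_pos V hq j
  have hb0 : 0 < b := hbj.trans_le (hb j)
  have h2 : 4 / b ≤ 4 / bandWidth V q j := div_le_div_of_nonneg_left (by norm_num) hbj (hb j)
  have h3 : z.im * ∏ i ∈ Finset.univ.erase j, |z.re - eigenvalue V q (Real.pi / 2) i|
      ≤ ‖discriminant V q z‖ := by
    rw [discriminant, norm_prod, ← Finset.mul_prod_erase _ _ (Finset.mem_univ j)]
    refine mul_le_mul ?_ (Finset.prod_le_prod (fun i _ => abs_nonneg _) fun i _ => ?_)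
      (Finset.prod_nonneg fun i _ => abs_nonneg _) (norm_nonneg _)
    · have := Complex.im_le_norm (z - eigenvalue V q (Real.pi / 2) j)
      simpa using this
    · have := Complex.abs_re_le_norm (z - eigenvalue V q (Real.pi / 2) i)
      simpa using this
  refine le_trans ?_ h3
  rw [mul_comm 4, mul_div_assoc]
  refine mul_le_mul_of_nonneg_left ?_ hz.le
  rw [mul_comm (Real.exp 1), ← div_div, div_le_iff₀ (Real.exp_pos 1), mul_comm _ (Real.exp 1)]
  exact h2.trans h1

/-- The Floquet multiplier is bounded by the largest band width. -/
theorem norm_green_apply_le (V : Potential) {q : ℕ} (hq : 1 < q) {p : ℕ+} (hp : (p : ℕ) = q)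
    {b : ℝ} (hb : ∀ j, bandWidth V q j ≤ b) {z : ℂ} (hz : 0 < z.im) :
    ‖green (periodization V q) z p‖ ≤ Real.exp 1 / 2 * (b / z.im) := by
  have hb0 : 0 < b := (bandWidth_pos V hq ⟨0, by omega⟩).trans_le (hb _)
  set μ := -(green (periodization V q) z p) with hμ
  have hnorm : ‖green (periodization V q) z p‖ = ‖μ‖ := (norm_neg _).symm
  rw [hnorm]
  rcases eq_or_ne μ 0 with h0 | h0
  · rw [h0, norm_zero]
    positivity
  have hle : ‖μ‖ ≤ 1 := by
    rw [← hnorm]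
    subst hp
    exact norm_green_apply_le_one (periodization_add V p) hz
  have hpos : 0 < ‖μ‖ := norm_pos_iff.2 h0
  have hdet := det_sub_cornerMatrix_green V hq hp hz hμ h0
  rw [det_sub_cornerMatrix V hq z (inv_mul_cancel₀ h0), sub_sub, sub_eq_zero] at hdet
  have h1 := le_norm_discriminant V hq hb hz
  -- From `D = μ⁻¹ + μ` and `‖μ‖ ≤ 1`.
  have h2 : ‖discriminant V q z‖ ≤ 2 / ‖μ‖ := by
    rw [hdet]
    refine (norm_add_le _ _).trans ?_
    rw [norm_inv, le_div_iff₀ hpos, add_mul, inv_mul_cancel₀ hpos.ne']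
    nlinarith
  have h3 := h1.trans h2
  have he := Real.exp_pos 1
  rw [div_le_div_iff₀ (by positivity) hpos] at h3
  rw [div_mul_div_comm, le_div_iff₀ (by positivity)]
  linarith

theorem norm_shiftLeft_pow_green_le_bandWidth (V : Potential) {q : ℕ} (hq : 1 < q) {b : ℝ}
    (hb : ∀ j, bandWidth V q j ≤ b) {z : ℂ} (hz : 0 < z.im) :
    ‖(shiftLeft ^ q) (green V z)‖ ≤ (1 + 2 * ‖V‖ / z.im) * (Real.exp 1 / 2 * (b / z.im))
      * ‖green (periodization V q) z‖ := by
  obtain ⟨p, rfl⟩ : ∃ p : ℕ+, (p : ℕ) = q := ⟨⟨q, by omega⟩, rfl⟩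
  have h1 := norm_shiftLeft_pow_green_le V (periodization V p) (p := p)
    (fun n hn => periodization_of_le V p n hn)
    (fun n => lp.norm_apply_le_norm ENNReal.top_ne_zero V _) hz
  rw [shiftLeft_pow_green (periodization_add V p) hz, norm_smul, norm_neg] at h1
  refine h1.trans ?_
  rw [mul_assoc]
  gcongr
  exact norm_green_apply_le V hq rfl hb hz

end

end HalfLine

/-! ### Assembly of the bound. -/

theorem mainTheorem3 (V : HalfLine.Potential) (q : ℕ) (hq : 1 < q) (T : ℝ) (hT : 1 ≤ T) :
    HalfLine.outsideProbability V q T ≤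
      ENNReal.ofReal
        (4 * Real.exp 1 ^ 2 / (Real.sqrt 5 + 1) ^ 2 * (1 + 2 * ‖V‖) ^ 2 * T ^ 6 *
          (⨆ j : Fin q, HalfLine.bandWidth V q j) ^ 2) := by
  have hT0 : 0 < T := by linarith
  set b := ⨆ j : Fin q, HalfLine.bandWidth V q j
  have hb : ∀ j, HalfLine.bandWidth V q j ≤ b := fun j => le_ciSup (Set.finite_range _).bddAbove j
  have hb0 : 0 < b := (HalfLine.bandWidth_pos V hq ⟨0, by omega⟩).trans_le (hb _)
  set K := (1 + 2 * ‖V‖ / T⁻¹) * (Real.exp 1 / 2 * (b / T⁻¹)) with hK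
  have hK0 : 0 ≤ K := by positivity
  have hpt : ∀ ξ : ℝ,
      ‖(HalfLine.shiftLeft ^ q) (HalfLine.green V (HalfLine.spectralParam T⁻¹ ξ))‖ₑ ^ 2
      ≤ ENNReal.ofReal (K ^ 2) * ‖HalfLine.green (HalfLine.periodization V q)
          (HalfLine.spectralParam T⁻¹ ξ)‖ₑ ^ 2 := by
    intro ξ
    have h := HalfLine.norm_shiftLeft_pow_green_le_bandWidth V hq hb
      (z := HalfLine.spectralParam T⁻¹ ξ) (by rw [HalfLine.spectralParam_im]; positivity)
    rw [HalfLine.spectralParam_im] at h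
    rw [ENNReal.ofReal_pow hK0, ← mul_pow, ← ofReal_norm, ← ofReal_norm, ← ENNReal.ofReal_mul hK0]
    gcongr
  have hmain : HalfLine.outsideProbability V q T ≤ ENNReal.ofReal (K ^ 2) := by
    rw [HalfLine.outsideProbability_eq V q hT0]
    calc _ ≤ ENNReal.ofReal (2 / T) * (ENNReal.ofReal (K ^ 2) * ∫⁻ ξ : ℝ,
          ‖HalfLine.green (HalfLine.periodization V q) (HalfLine.spectralParam T⁻¹ ξ)‖ₑ ^ 2) := by
          gcongr
          rw [← MeasureTheory.lintegral_const_mul' _ _ ENNReal.ofReal_ne_top]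
          exact MeasureTheory.lintegral_mono hpt
      _ = ENNReal.ofReal (K ^ 2) := by
          rw [mul_left_comm, HalfLine.lintegral_norm_green _ hT0, mul_one]
  refine hmain.trans (ENNReal.ofReal_le_ofReal ?_)
  -- This makes `e/2`, the constant obtained for the multiplier, at most `2e/(√5 + 1)`.
  have h5 : Real.sqrt 5 ≤ 3 := by
    rw [Real.sqrt_le_left (by norm_num)]
    norm_num
  have h5' : 0 ≤ Real.sqrt 5 := Real.sqrt_nonneg 5
  have he := Real.exp_pos 1
  have hV := norm_nonneg V
  have hle : K ≤ 2 * Real.exp 1 / (Real.sqrt 5 + 1) * (1 + 2 * ‖V‖) * T ^ 3 * b := by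
    have e1 : K = (1 + 2 * ‖V‖ * T) * (Real.exp 1 / 2 * (b * T)) := by
      rw [hK, div_inv_eq_mul, div_inv_eq_mul]
    have e2 : 1 + 2 * ‖V‖ * T ≤ (1 + 2 * ‖V‖) * T := by nlinarith
    have e3 : Real.exp 1 / 2 ≤ 2 * Real.exp 1 / (Real.sqrt 5 + 1) := by
      rw [div_le_div_iff₀ (by norm_num) (by positivity)]
      nlinarith
    have e4 : T ^ 2 ≤ T ^ 3 := pow_le_pow_right₀ hT (by norm_num)
    calc K ≤ ((1 + 2 * ‖V‖) * T) * (2 * Real.exp 1 / (Real.sqrt 5 + 1) * (b * T)) := by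
          rw [e1]
          gcongr
      _ = 2 * Real.exp 1 / (Real.sqrt 5 + 1) * (1 + 2 * ‖V‖) * T ^ 2 * b := by ring
      _ ≤ _ := by gcongr
  calc K ^ 2 ≤ (2 * Real.exp 1 / (Real.sqrt 5 + 1) * (1 + 2 * ‖V‖) * T ^ 3 * b) ^ 2 := by
        gcongr
    _ = _ := by
        simp only [mul_pow, div_pow]
        ring
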